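/- For positive integers $t$ and $m$ define the real numbers $c_t^{(m)}(n)$, $n\ge 0$, by $$\left(\prod_{k=1}^\infty \frac{1-q^k}{1-q^{tk}}\right)^{m}=\sum_{n=0}^\infty c_t^{(m)}(n)\,q^n .$$ For a real number $x$ let $\mathrm{sgn}(x)=1$, $0$, $-1$ according to whether $x>0$, $x=0$, $x<0$. A sequence $\{a(n)\}_{n\ge 0}$ of real numbers is called ultimately periodic in sign (a UPS sequence) if there is a positive integer $s$ such that $\mathrm{sgn}(a(n))=\mathrm{sgn}(a(n+s))$ for all sufficiently large $n$; every such $s$ is called a period of sign, and the smallest one is called the least period of sign. Then $\{c_t^{(m)}(n)\}_{n\ge 0}$ is a UPS sequence whose least period of sign is divisible by $t$ in each of the following cases: 1. $t=2$ and $m$ is any positive integer; 2. $t=p$ is any prime and $m=1$ or $m=3$. -/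

import Mathlib

noncomputable section

namespace Borwein

open scoped PowerSeries.WithPiTopology

/-- The formal power series `(q^t; q^t)_∞ = ∏_{n ≥ 1} (1 - q^{t n})`, where `q` is the variable
`PowerSeries.X`, as an infinite product for the product topology on `ℝ⟦q⟧`
(it converges for `t ≥ 1`). -/
def qProd (t : ℕ) : PowerSeries ℝ :=
  ∏' n : ℕ, (1 - (PowerSeries.X : PowerSeries ℝ) ^ (t * (n + 1)))

/-- The infinite Borwein product `G_t(q) = (q; q)_∞ / (q^t; q^t)_∞`. -/
def borweinProduct (t : ℕ) : PowerSeries ℝ :=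
  qProd 1 * (qProd t)⁻¹

/-- `c_t^{(m)}(n)`: the coefficient of `q^n` in `G_t(q)^m`. -/
def c (t m n : ℕ) : ℝ :=
  PowerSeries.coeff n (borweinProduct t ^ m)

/-- `s` is a period of sign of `a`: it is positive and `sgn a(n) = sgn a(n + s)` for all
sufficiently large `n`, where `sgn` takes the value `0` at `0`. -/
def IsPeriodOfSign (a : ℕ → ℝ) (s : ℕ) : Prop :=
  0 < s ∧ ∃ N : ℕ, ∀ n : ℕ, N ≤ n → SignType.sign (a n) = SignType.sign (a (n + s))

/-- `a` is ultimately periodic in sign. -/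
def IsUPS (a : ℕ → ℝ) : Prop :=
  ∃ s : ℕ, IsPeriodOfSign a s

/-- `s` is the least period of sign of `a`. -/
def IsLeastPeriodOfSign (a : ℕ → ℝ) (s : ℕ) : Prop :=
  IsLeast {s' : ℕ | IsPeriodOfSign a s'} s

/-- The sign-periodicity property of the pair `(t, m)`: the sequence `n ↦ c_t^{(m)}(n)` is
ultimately periodic in sign, and its least period of sign is divisible by `t`. -/
def SignConjecture (t m : ℕ) : Prop :=
  IsUPS (c t m) ∧ ∃ s : ℕ, IsLeastPeriodOfSign (c t m) s ∧ t ∣ s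

/-- The infinite product defining `qProd t` converges for `t ≥ 1`. -/
theorem multipliable_qProd (t : ℕ) (ht : 0 < t) :
    Multipliable fun n : ℕ => (1 - (PowerSeries.X : PowerSeries ℝ) ^ (t * (n + 1))) := by
  simp_rw [sub_eq_add_neg]
  apply PowerSeries.WithPiTopology.multipliable_one_add_of_tendsto_order_atTop_nhds_top
  refine ENat.tendsto_nhds_top_iff_natCast_lt.mpr
    (fun n => Filter.eventually_atTop.mpr ⟨n, fun k hk => ?_⟩)
  rw [PowerSeries.order_neg, PowerSeries.order_X_pow]
  norm_cast
  nlinarith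

/-- For `t ≥ 1` the series `qProd t` has constant term `1`. -/
theorem constantCoeff_qProd (t : ℕ) (ht : 0 < t) :
    PowerSeries.constantCoeff (qProd t) = 1 := by
  have ht' : t ≠ 0 := ht.ne'
  rw [qProd, (multipliable_qProd t ht).map_tprod _
    (PowerSeries.WithPiTopology.continuous_constantCoeff ℝ)]
  simp [ht']

/-- For `t ≥ 1` the quotient in `borweinProduct t` is a genuine quotient of power series. -/
theorem borweinProduct_mul_qProd (t : ℕ) (ht : 0 < t) :
    borweinProduct t * qProd t = qProd 1 := by
  have h : PowerSeries.constantCoeff (qProd t) ≠ 0 := by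
    rw [constantCoeff_qProd t ht]; exact one_ne_zero
  rw [borweinProduct, mul_assoc, PowerSeries.inv_mul_cancel _ h, mul_one]

end Borwein

end

/-! Write E(q) = (q;q)_∞. The denominator of the Borwein product G_p is E(q^p), so extracting the
coefficients at p n + r from G_p^m amounts to extracting them from E^m and dividing by E(q)^m
(`comp_borweinProduct_pow`). For m = 1 and m = 3, E^m is a sparse theta series (Euler's pentagonal
series, Jacobi's cube), and each of its residue classes can be summed in closed form.

A class is empty, or its indices k form one progression mod p, or two swapped by a reflection. Each
nonempty class equals ± q^s times theta products, possibly with an extra factor whose sign is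
controlled. After cancellation against E^m, what remains is a series with nonnegative coefficients
and positive constant term, times generating functions of partitions into restricted parts. These
are positive from degree 2 on, so the sign is eventually constant and nonzero on each nonempty class
(`eventually_sign_of_mul_partProd`).

For m = 3 the two progressions give a triple product and its derivative; the Lambert series in the
derivative becomes nonnegative after division by 1 - q. For m = 1 and p ≥ 5 they add up to a
quintuple product. For p = 3, m = 1 the three classes are triple products with modulus 9. For t = 2,
G_2 = (q;q²)_∞, and q ↦ -q makes all coefficients of its powers nonnegative.

Hence p is a period of sign and the least period divides p. It is not 1, because two classes have
different signs: for t = 2 and for p = 3, m = 1 both signs occur, and otherwise a quadratic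
nonresidue produces an empty class (`signConjecture_of_eventually_sign`). -/

noncomputable section

namespace Borwein

open PowerSeries Finset Filter Topology
open scoped PowerSeries.WithPiTopology

/-! ### Finite triple product over a commutative ring -/

/-- A finite form of the Jacobi triple product identity. -/
theorem finite_triple_product {A : Type*} [CommRing A] (q x y : A) (T : ℕ → A) (w : ℤ → A)
    (hq : ∀ k : ℕ, IsUnit (1 - q ^ (k + 1)))
    (hT : ∀ k, T k = (1 - q ^ (k + 1)) * T (k + 1)) (h0 : w 0 = 1)
    (hx : ∀ m l : ℕ, x * q ^ m * w (m - l) = q ^ l * w (m - l + 1))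
    (hy : ∀ n k : ℕ, y * q ^ n * w (k - n) = q ^ k * w (k - n - 1)) (m n : ℕ) :
    T 0 * (∏ i ∈ range m, (1 + x * q ^ i)) * (∏ i ∈ range n, (1 + y * q ^ i)) * T (m + n) =
      ∑ kl ∈ antidiagonal (m + n), T kl.1 * T kl.2 * w (kl.1 - n) := by
  have hT' : ∀ k, (1 - q ^ (k + 1)) * T (k + 1) = T k := fun k => (hT k).symm
  -- `T k` plays the role of (q^(k+1);q)_∞, so the sum is the q-binomial theorem without
  -- denominators. The two recursions are the two q-Pascal rules, from 1 - q^(k+l) = (1 - q^l) + q^l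
  -- (1 - q^k) and its mirror image; they add one factor in `x` and one in `y` respectively.
  have key1 : ∀ m n : ℕ, (1 - q ^ (m + n + 1)) *
      ∑ kl ∈ antidiagonal (m + n + 1), T kl.1 * T kl.2 * w (kl.1 - n) =
      (1 + x * q ^ m) * ∑ kl ∈ antidiagonal (m + n), T kl.1 * T kl.2 * w (kl.1 - n) := by
    intro m n
    have e : ∀ kl ∈ antidiagonal (m + n + 1),
        (1 - q ^ (m + n + 1)) * (T kl.1 * T kl.2 * w (kl.1 - n)) =
        (1 - q ^ kl.2) * T kl.2 * (T kl.1 * w (kl.1 - n)) +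
        (1 - q ^ kl.1) * T kl.1 * (q ^ kl.2 * T kl.2 * w (kl.1 - n)) := by
      intro kl h
      rw [← mem_antidiagonal.1 h, pow_add]; ring
    rw [mul_sum, sum_congr rfl e, sum_add_distrib, Finset.Nat.sum_antidiagonal_succ',
      Finset.Nat.sum_antidiagonal_succ]
    simp only [pow_zero, sub_self, zero_mul, zero_add, hT']
    rw [add_mul, one_mul, mul_sum]
    congr 1
    · exact sum_congr rfl fun kl _ => by ring
    · refine sum_congr rfl fun kl h => ?_
      have h2 : (kl.1 : ℤ) - n = m - kl.2 := by
        have := mem_antidiagonal.1 h; omega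
      have := hx m kl.2
      rw [show ((kl.1 + 1 : ℕ) : ℤ) - n = m - kl.2 + 1 by push_cast; linarith, h2]
      linear_combination -(T kl.1 * T kl.2) * this
  have key2 : ∀ m n : ℕ, (1 - q ^ (m + n + 1)) *
      ∑ kl ∈ antidiagonal (m + n + 1), T kl.1 * T kl.2 * w (kl.1 - (n + 1 : ℕ)) =
      (1 + y * q ^ n) * ∑ kl ∈ antidiagonal (m + n), T kl.1 * T kl.2 * w (kl.1 - n) := by
    intro m n
    have e : ∀ kl ∈ antidiagonal (m + n + 1),
        (1 - q ^ (m + n + 1)) * (T kl.1 * T kl.2 * w (kl.1 - (n + 1 : ℕ))) =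
        (1 - q ^ kl.1) * T kl.1 * (T kl.2 * w (kl.1 - (n + 1 : ℕ))) +
        (1 - q ^ kl.2) * T kl.2 * (q ^ kl.1 * T kl.1 * w (kl.1 - (n + 1 : ℕ))) := by
      intro kl h
      rw [← mem_antidiagonal.1 h, pow_add]; ring
    rw [mul_sum, sum_congr rfl e, sum_add_distrib, Finset.Nat.sum_antidiagonal_succ,
      Finset.Nat.sum_antidiagonal_succ']
    simp only [pow_zero, sub_self, zero_mul, zero_add, hT']
    rw [add_mul, one_mul, mul_sum]
    congr 1
    · refine sum_congr rfl fun kl _ => ?_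
      rw [show ((kl.1 + 1 : ℕ) : ℤ) - (n + 1 : ℕ) = kl.1 - n by push_cast; ring]; ring
    · refine sum_congr rfl fun kl h => ?_
      have := hy n kl.1
      rw [show ((kl.1 : ℕ) : ℤ) - (n + 1 : ℕ) = kl.1 - n - 1 by push_cast; ring]
      linear_combination -(T kl.1 * T kl.2) * this
  induction n with
  | zero =>
    induction m with
    | zero => simp [h0]
    | succ m ih =>
      apply (hq (m + 0)).mul_left_cancel
      rw [show m + 1 + 0 = m + 0 + 1 by ring, key1 m 0, ← ih, prod_range_succ, hT (m + 0)]
      ring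
  | succ n ih =>
    apply (hq (m + n)).mul_left_cancel
    rw [← add_assoc, key2 m n, ← ih, prod_range_succ, hT (m + n)]
    ring

/-! ### Theta exponents and the infinite triple product -/

/-- The triangular number `j (j + 1) / 2`, for an integer `j`. -/
def tri (j : ℤ) : ℕ := (j * (j + 1) / 2).toNat

theorem tri_cast (j : ℤ) : (tri j : ℤ) * 2 = j * (j + 1) := by
  have h := Int.even_mul_succ_self j
  have h2 : 0 ≤ j * (j + 1) := by
    rcases le_or_gt 0 j with h | h <;> nlinarith
  obtain ⟨k, hk⟩ := h
  rw [tri, Int.toNat_of_nonneg (by omega)]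
  omega

/-- The exponent `u j (j + 1) / 2 + v j (j - 1) / 2`. -/
def jexp (u v : ℕ) (j : ℤ) : ℕ := u * tri j + v * tri (-j)

theorem jexp_cast (u v : ℕ) (j : ℤ) :
    (jexp u v j : ℤ) * 2 = u * (j * (j + 1)) + v * (j * (j - 1)) := by
  have h1 := tri_cast j
  have h2 := tri_cast (-j)
  simp only [jexp]; push_cast
  linear_combination u * h1 + v * h2

theorem abs_le_of_jexp_le {u v : ℕ} (h : 0 < u + v) {j : ℤ} {d : ℕ} (hj : jexp u v j ≤ d) :
    |j| ≤ d + 1 := by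
  have h1 := jexp_cast u v j
  have hj' : (jexp u v j : ℤ) ≤ d := by exact_mod_cast hj
  by_contra! hc
  have a1 : j * (j + 1) ≥ |j| * (|j| - 1) := by
    rcases abs_cases j with ⟨h, _⟩ | ⟨h, _⟩ <;> (rw [h]; nlinarith)
  have a2 : j * (j - 1) ≥ |j| * (|j| - 1) := by
    rcases abs_cases j with ⟨h, _⟩ | ⟨h, _⟩
    · rw [h]
    · rw [h]; nlinarith
  have a3 : |j| * (|j| - 1) ≥ 2 * (d + 1) := by nlinarith
  have hu : (0 : ℤ) ≤ u := by positivity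
  have hv : (0 : ℤ) ≤ v := by positivity
  have huv : (1 : ℤ) ≤ u + v := by exact_mod_cast h
  nlinarith [mul_le_mul_of_nonneg_left a1 hu, mul_le_mul_of_nonneg_left a2 hv]

theorem multipliable_one_add_of_X_pow_dvd {f : ℕ → ℝ⟦X⟧} (h : ∀ n, X ^ n ∣ f n) :
    Multipliable fun n => 1 + f n := by
  apply WithPiTopology.multipliable_one_add_of_tendsto_order_atTop_nhds_top
  refine ENat.tendsto_nhds_top_iff_natCast_lt.mpr
    (fun n => Filter.eventually_atTop.mpr ⟨n + 1, fun k hk => ?_⟩)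
  have h1 : (k : ℕ∞) ≤ (f k).order := X_pow_dvd_iff.1 (h k) |> fun h => PowerSeries.le_order _ _
    (fun i hi => h i (by exact_mod_cast hi))
  exact lt_of_lt_of_le (by exact_mod_cast hk) h1

/-- The infinite product `∏ (1 + α X ^ (u + p n))`. -/
def poch (α : ℝ) (u p : ℕ) : ℝ⟦X⟧ := ∏' n : ℕ, (1 + C α * X ^ (u + p * n))

theorem multipliable_poch (α : ℝ) (u : ℕ) {p : ℕ} (hp : 0 < p) :
    Multipliable fun n : ℕ => (1 + C α * X ^ (u + p * n) : ℝ⟦X⟧) :=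
  multipliable_one_add_of_X_pow_dvd fun n =>
    Dvd.dvd.mul_left (pow_dvd_pow _ (by nlinarith)) _

theorem poch_neg_one (u p : ℕ) : poch (-1) u p = ∏' n : ℕ, (1 - X ^ (u + p * n)) := by
  simp [poch, sub_eq_add_neg]

theorem poch_eq_mul (α : ℝ) (u : ℕ) {p : ℕ} (hp : 0 < p) :
    poch α u p = (1 + C α * X ^ u) * poch α (u + p) p := by
  have h := multipliable_poch α (u + p) hp
  rw [poch, poch, tprod_eq_zero_mul']
  · simp only [mul_zero, add_zero]
    congr 2 with n
    ring_nf
  · convert h using 4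
    ring

theorem qProd_eq_poch (p : ℕ) : qProd p = poch (-1) p p := by
  rw [poch_neg_one, qProd]
  congr 1 with n
  ring_nf

theorem X_pow_dvd_poch_sub_one (α : ℝ) (u : ℕ) {p : ℕ} (hp : 0 < p) :
    X ^ u ∣ poch α u p - 1 := by
  rw [X_pow_dvd_iff]
  intro d hd
  have h := ((WithPiTopology.tendsto_iff_coeff_tendsto _ _ _ _).1
    (multipliable_poch α u hp).hasProd.tendsto_prod_nat) d
  refine tendsto_nhds_unique (f := fun _ : ℕ => (0:ℝ)) (l := atTop) ?_ tendsto_const_nhds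
  rw [map_sub]
  refine Tendsto.congr ?_ (h.sub_const (coeff d 1))
  intro n
  rw [← map_sub]
  have : X ^ u ∣ (∏ i ∈ range n, (1 + C α * X ^ (u + p * i)) : ℝ⟦X⟧) - 1 := by
    induction n with
    | zero => simp
    | succ n ih =>
      rw [prod_range_succ]
      have e : (X : ℝ⟦X⟧) ^ u ∣ C α * X ^ (u + p * n) := Dvd.dvd.mul_left (pow_dvd_pow _ (by simp)) _
      convert (dvd_add ih (e.mul_right (∏ i ∈ range n, (1 + C α * X ^ (u + p * i))))) using 1
      ring
  exact X_pow_dvd_iff.1 this d hd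

theorem coeff_mul_of_X_pow_dvd {k d : ℕ} {f g : ℝ⟦X⟧} (h : X ^ k ∣ f - 1) (hd : d < k) :
    coeff d (f * g) = coeff d g := by
  have := X_pow_dvd_iff.1 (h.mul_right g) d hd
  rw [sub_mul, one_mul, map_sub, sub_eq_zero] at this
  exact this

/-- For a fixed degree d only |j| ≤ d + 1 contributes, and there the weights `T` are 1 up to terms
of degree above d once n is large. The coefficients `c` are arbitrary, so the same limit serves the
identity and its derivative. -/
theorem hasSum_theta_of_tendsto {u v : ℕ} (hp : 0 < u + v) (T : ℕ → ℝ⟦X⟧)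
    (hT : ∀ k, X ^ (k + 1) ∣ T k - 1) (c : ℤ → ℝ) {P : ℝ⟦X⟧}
    (h : Tendsto (fun n : ℕ => ∑ kl ∈ antidiagonal (n + n),
      T kl.1 * T kl.2 * (C (c (kl.1 - n)) * X ^ jexp u v (kl.1 - n))) atTop (𝓝 P)) :
    HasSum (fun j : ℤ => C (c j) * X ^ jexp u v j) P := by
  rw [WithPiTopology.hasSum_iff_hasSum_coeff]
  intro d
  have hz : ∀ j : ℤ, j ∉ Icc (-(d + 1) : ℤ) (d + 1) → d < jexp u v j := by
    intro j hj
    by_contra! hc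
    exact hj (Finset.mem_Icc.2 (abs_le.1 (abs_le_of_jexp_le hp hc)))
  have h1 : HasSum (fun j : ℤ => coeff d (C (c j) * X ^ jexp u v j : ℝ⟦X⟧))
      (∑ j ∈ Icc (-(d + 1) : ℤ) (d + 1), coeff d (C (c j) * X ^ jexp u v j : ℝ⟦X⟧)) := by
    apply hasSum_sum_of_ne_finset_zero
    intro j hj
    rw [coeff_C_mul_X_pow, if_neg (hz j hj).ne]
  suffices coeff d P = ∑ j ∈ Icc (-(d + 1) : ℤ) (d + 1), coeff d (C (c j) * X ^ jexp u v j : ℝ⟦X⟧) by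
    rwa [this]
  have h2 := ((WithPiTopology.tendsto_iff_coeff_tendsto _ _ _ _).1 h) d
  refine tendsto_nhds_unique h2 (tendsto_const_nhds.congr' ?_)
  -- With |j| ≤ d + 1 this bound makes both indices n + j and n - j exceed d.
  filter_upwards [eventually_ge_atTop (2 * d + 2)] with n hn
  rw [Finset.Nat.sum_antidiagonal_eq_sum_range_succ_mk, map_sum]
  refine Finset.sum_of_injOn (fun j : ℤ => (j + n).toNat) ?_ ?_ ?_ ?_
  · intro i hi j hj hij
    simp only [coe_Icc, Set.mem_Icc] at hi hj hij
    omega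
  · intro i hi
    simp only [coe_Icc, Set.mem_Icc, coe_range, Set.mem_Iio] at hi ⊢
    omega
  · intro k hk hk'
    have : d < jexp u v ((k : ℤ) - n) := by
      apply hz
      intro hc
      refine hk' ⟨(k : ℤ) - n, hc, by simp⟩
    dsimp only
    rw [mul_comm, mul_assoc, coeff_C_mul, coeff_X_pow_mul', if_neg (by omega), mul_zero]
  · intro j hj
    simp only [Finset.mem_Icc] at hj
    have e : (((j + n).toNat : ℕ) : ℤ) - n = j := by omega
    simp only [e]
    rw [mul_assoc, coeff_mul_of_X_pow_dvd (hT _) (by omega),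
      coeff_mul_of_X_pow_dvd (hT _) (by omega)]

theorem jexp_add_one (u v m l : ℕ) :
    u + (u + v) * m + jexp u v (m - l) = (u + v) * l + jexp u v (m - l + 1) := by
  have h1 := jexp_cast u v (m - l)
  have h2 := jexp_cast u v (m - l + 1)
  zify
  apply mul_right_cancel₀ (two_ne_zero (α := ℤ))
  linear_combination h1 - h2

theorem jexp_sub_one (u v n k : ℕ) :
    v + (u + v) * n + jexp u v (k - n) = (u + v) * k + jexp u v (k - n - 1) := by
  have h1 := jexp_cast u v (k - n)
  have h2 := jexp_cast u v (k - n - 1)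
  zify
  apply mul_right_cancel₀ (two_ne_zero (α := ℤ))
  linear_combination h1 - h2

theorem jexp_zero (u v : ℕ) : jexp u v 0 = 0 := by simp [jexp, tri]

theorem isUnit_one_sub_X_pow {k : ℕ} (hk : 0 < k) : IsUnit (1 - X ^ k : ℝ⟦X⟧) := by
  rw [isUnit_iff_constantCoeff]
  simp [hk.ne']

/-- The tail `∏ (1 - X ^ (p n))` over `n > k`. -/
def qTail (p k : ℕ) : ℝ⟦X⟧ := poch (-1) (p * (k + 1)) p

theorem qTail_zero (p : ℕ) : qTail p 0 = qProd p := by simp [qTail, qProd_eq_poch]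

theorem qTail_eq_mul {p : ℕ} (hp : 0 < p) (k : ℕ) :
    qTail p k = (1 - (X ^ p) ^ (k + 1)) * qTail p (k + 1) := by
  rw [qTail, poch_eq_mul _ _ hp, qTail, ← pow_mul]
  simp [sub_eq_add_neg, mul_add]

theorem X_pow_dvd_qTail_sub_one {p : ℕ} (hp : 0 < p) (k : ℕ) : X ^ (k + 1) ∣ qTail p k - 1 :=
  (pow_dvd_pow _ (by nlinarith)).trans (X_pow_dvd_poch_sub_one _ _ hp)

theorem tendsto_one_of_X_pow_dvd {T : ℕ → ℝ⟦X⟧} (hT : ∀ k, X ^ (k + 1) ∣ T k - 1) :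
    Tendsto T atTop (𝓝 1) := by
  rw [WithPiTopology.tendsto_iff_coeff_tendsto]
  intro d
  refine tendsto_const_nhds.congr' ?_
  filter_upwards [eventually_ge_atTop d] with n hn
  rw [← mul_one (T n), coeff_mul_of_X_pow_dvd (hT n) (by omega)]

theorem tendsto_qTail_add_self {p : ℕ} (hp : 0 < p) :
    Tendsto (fun n => qTail p (n + n)) atTop (𝓝 1) :=
  tendsto_one_of_X_pow_dvd fun k =>
    (pow_dvd_pow _ (by omega)).trans (X_pow_dvd_qTail_sub_one hp (k + k))

theorem tendsto_prod_poch (α : ℝ) (u : ℕ) {p : ℕ} (hp : 0 < p) :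
    Tendsto (fun n => ∏ i ∈ range n, (1 + C α * X ^ u * (X ^ p) ^ i : ℝ⟦X⟧)) atTop
      (𝓝 (poch α u p)) := by
  refine (multipliable_poch α u hp).hasProd.tendsto_prod_nat.congr fun n => ?_
  refine prod_congr rfl fun i _ => ?_
  rw [pow_add, pow_mul, mul_assoc]

/-- The Jacobi triple product identity. -/
theorem jacobi_triple_product {α : ℝ} (hα : α ≠ 0) {u v p : ℕ} (hp : 0 < p) (h : u + v = p) :
    HasSum (fun j : ℤ => (C (α ^ j) * X ^ jexp u v j : ℝ⟦X⟧))
      (poch α u p * poch α⁻¹ v p * qProd p) := by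
  subst h
  refine hasSum_theta_of_tendsto hp (qTail (u + v)) (X_pow_dvd_qTail_sub_one hp) (fun j => α ^ j) ?_
  have key := fun n => finite_triple_product (A := ℝ⟦X⟧) (X ^ (u + v)) (C α * X ^ u) (C α⁻¹ * X ^ v)
    (qTail (u + v)) (fun j => C (α ^ j) * X ^ jexp u v j)
    (fun k => by rw [← pow_mul]; exact isUnit_one_sub_X_pow (by positivity))
    (qTail_eq_mul hp) (by simp [jexp_zero])
    (fun m l => by
      have e := congrArg (fun k : ℕ => (X : ℝ⟦X⟧) ^ k) (jexp_add_one u v m l)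
      simp only [pow_add, pow_mul] at e ⊢
      rw [zpow_add₀ hα, zpow_one, map_mul]
      linear_combination (C α * C (α ^ ((m : ℤ) - l))) * e)
    (fun n k => by
      have e := congrArg (fun k : ℕ => (X : ℝ⟦X⟧) ^ k) (jexp_sub_one u v n k)
      simp only [pow_add, pow_mul] at e ⊢
      rw [zpow_sub_one₀ hα, map_mul]
      linear_combination (C α⁻¹ * C (α ^ ((k : ℤ) - n))) * e) n n
  refine Tendsto.congr key ?_
  have := ((tendsto_const_nhds (x := qTail (u + v) 0)).mul (tendsto_prod_poch α u hp)).mul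
    (tendsto_prod_poch α⁻¹ v hp) |>.mul (tendsto_qTail_add_self hp)
  convert this using 2
  rw [qTail_zero]; ring

/-! ### Derivative of the triple product via dual numbers -/

section DualNumbers

open TrivSqZeroExt

/-- The factor `1 - (1 + c ε) X ^ k` over the dual numbers. -/
def dualFactor (c : ℝ⟦X⟧) (u p i : ℕ) : DualNumber ℝ⟦X⟧ :=
  1 + (inl (-X ^ u) + inr (-(c * X ^ u))) * (inl (X ^ p)) ^ i

theorem fst_dualFactor (c : ℝ⟦X⟧) (u p i : ℕ) :
    (dualFactor c u p i).fst = 1 - X ^ (u + p * i) := by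
  simp [dualFactor, pow_add, pow_mul, sub_eq_add_neg]

theorem snd_dualFactor (c : ℝ⟦X⟧) (u p i : ℕ) :
    (dualFactor c u p i).snd = -(c * X ^ (u + p * i)) := by
  simp [dualFactor, pow_add, pow_mul]
  ring

theorem fst_prod {A : Type*} [CommRing A] (f : ℕ → DualNumber A) (n : ℕ) :
    (∏ i ∈ range n, f i).fst = ∏ i ∈ range n, (f i).fst :=
  map_prod (fstHom A A A) f (range n)

theorem fst_prod_dualFactor (c : ℝ⟦X⟧) (u p n : ℕ) :
    (∏ i ∈ range n, dualFactor c u p i).fst = ∏ i ∈ range n, (1 - X ^ (u + p * i)) := by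
  rw [fst_prod, prod_congr rfl fun i _ => fst_dualFactor c u p i]

/-- The ε-part is a derivation, so this is the logarithmic derivative of a product, with `g i` that
of the i-th factor. -/
theorem snd_prod_of_eq_mul {A : Type*} [CommRing A] {f : ℕ → DualNumber A} {g : ℕ → A}
    (h : ∀ i, (f i).snd = (f i).fst * g i) (n : ℕ) :
    (∏ i ∈ range n, f i).snd = (∏ i ∈ range n, (f i).fst) * ∑ i ∈ range n, g i := by
  induction n with
  | zero => simp
  | succ n ih =>
    rw [prod_range_succ, snd_mul, ih, h, fst_prod, prod_range_succ, sum_range_succ]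
    simp
    ring

/-- Take the parameter z = -(1 + ε), whose inverse is -(1 - ε): then z^j = (-1)^j (1 + j ε), and
comparing ε-parts in the finite identity differentiates it. -/
theorem finite_triple_product_deriv {u v p : ℕ} (hp : 0 < p) (h : u + v = p) (n : ℕ) :
    qTail p 0 * ((∏ i ∈ range n, dualFactor 1 u p i) * ∏ i ∈ range n, dualFactor (-1) v p i).snd *
      qTail p (n + n) = ∑ kl ∈ antidiagonal (n + n), qTail p kl.1 * qTail p kl.2 *
        (C ((-1) ^ ((kl.1 : ℤ) - n) * (((kl.1 : ℤ) - n : ℤ) : ℝ)) * X ^ jexp u v (kl.1 - n)) := by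
  subst h
  have hz : (-1 : ℝ) ≠ 0 := by norm_num
  have key := finite_triple_product (A := DualNumber ℝ⟦X⟧) (inl (X ^ (u + v)))
    (inl (-X ^ u) + inr (-(1 * X ^ u))) (inl (-X ^ v) + inr (-(-1 * X ^ v)))
    (fun k => inl (qTail (u + v) k))
    (fun j => inl (C ((-1) ^ j) * X ^ jexp u v j) + inr (C ((-1) ^ j * (j : ℝ)) * X ^ jexp u v j))
    (fun k => by
      have : IsUnit (1 - X ^ ((u + v) * (k + 1)) : ℝ⟦X⟧) := isUnit_one_sub_X_pow (by positivity)
      have := this.map (inlHom ℝ⟦X⟧ ℝ⟦X⟧)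
      simpa [pow_mul] using this)
    (fun k => by
      ext1
      · simpa using qTail_eq_mul hp k
      · simp)
    (by ext <;> simp [jexp_zero])
    (fun m l => by
      have e := congrArg (fun k : ℕ => (X : ℝ⟦X⟧) ^ k) (jexp_add_one u v m l)
      simp only [pow_add, pow_mul] at e
      ext1
      · simp only [fst_mul, fst_add, fst_inl, fst_inr, add_zero, fst_pow]
        rw [zpow_add₀ hz, zpow_one, map_mul, ← pow_mul, ← pow_mul]
        simp [pow_add, pow_mul] at e ⊢
        linear_combination (C ((-1 : ℝ) ^ ((m : ℤ) - l))) * e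
      · simp only [fst_mul, fst_add, fst_inl, fst_inr, add_zero, fst_pow, snd_mul, snd_add, snd_inl,
          snd_inr, zero_add, snd_pow, smul_eq_mul, op_smul_eq_smul, smul_zero,
          mul_zero]
        rw [zpow_add₀ hz, zpow_one, map_mul]
        simp [pow_add] at e ⊢
        linear_combination (-C ((-1 : ℝ) ^ ((m : ℤ) - l)) * ((m : ℝ⟦X⟧) - l + 1)) * e)
    (fun n k => by
      have e := congrArg (fun k : ℕ => (X : ℝ⟦X⟧) ^ k) (jexp_sub_one u v n k)
      simp only [pow_add, pow_mul] at e
      ext1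
      · simp only [fst_mul, fst_add, fst_inl, fst_inr, add_zero, fst_pow]
        rw [zpow_sub_one₀ hz, map_mul, ← pow_mul, ← pow_mul]
        simp [pow_add, pow_mul] at e ⊢
        linear_combination (C ((-1 : ℝ) ^ ((k : ℤ) - n))) * e
      · simp only [fst_mul, fst_add, fst_inl, fst_inr, add_zero, fst_pow, snd_mul, snd_add, snd_inl,
          snd_inr, zero_add, snd_pow, smul_eq_mul, op_smul_eq_smul, smul_zero,
          mul_zero]
        rw [zpow_sub_one₀ hz, map_mul]
        simp [pow_add] at e ⊢
        linear_combination (-C ((-1 : ℝ) ^ ((k : ℤ) - n)) * ((k : ℝ⟦X⟧) - n - 1)) * e) n n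
  have key2 := congrArg snd key
  rw [snd_sum] at key2
  convert key2 using 1
  · rw [mul_assoc (inl _)]
    simp [dualFactor]
  · exact sum_congr rfl fun kl _ => by simp

/-- The series `X ^ d / (1 - X ^ d)`. -/
def lambert (d : ℕ) : ℝ⟦X⟧ := X ^ d * (1 - X ^ d)⁻¹

theorem one_sub_mul_lambert {d : ℕ} (hd : 0 < d) : (1 - X ^ d) * lambert d = X ^ d := by
  rw [lambert, mul_left_comm, PowerSeries.mul_inv_cancel _ (by simp [hd.ne']), mul_one]

theorem summable_of_X_pow_dvd {f : ℕ → ℝ⟦X⟧} (h : ∀ n, X ^ n ∣ f n) : Summable f := by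
  apply WithPiTopology.summable_of_tendsto_order_atTop_nhds_top
  refine ENat.tendsto_nhds_top_iff_natCast_lt.mpr
    (fun n => Filter.eventually_atTop.mpr ⟨n + 1, fun k hk => ?_⟩)
  have h1 : (k : ℕ∞) ≤ (f k).order := PowerSeries.le_order _ _
    (fun i hi => X_pow_dvd_iff.1 (h k) i (by exact_mod_cast hi))
  exact lt_of_lt_of_le (by exact_mod_cast hk) h1

theorem summable_lambert (u : ℕ) {p : ℕ} (hp : 0 < p) :
    Summable fun n : ℕ => lambert (u + p * n) :=
  summable_of_X_pow_dvd fun n => (pow_dvd_pow _ (by nlinarith)).mul_right _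

/-- The derivative of the Jacobi triple product identity at `z = 1`. -/
theorem jacobi_triple_product_deriv {u v p : ℕ} (hu : 0 < u) (hv : 0 < v) (h : u + v = p) :
    HasSum (fun j : ℤ => (C ((-1) ^ j * (j : ℝ)) * X ^ jexp u v j : ℝ⟦X⟧))
      (poch (-1) u p * poch (-1) v p * qProd p *
        ∑' n : ℕ, (lambert (v + p * n) - lambert (u + p * n))) := by
  have hp : 0 < p := by omega
  refine hasSum_theta_of_tendsto (by omega) (qTail p) (X_pow_dvd_qTail_sub_one hp)
    (fun j => (-1) ^ j * (j : ℝ)) ?_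
  refine Tendsto.congr (finite_triple_product_deriv hp h) ?_
  have e1 : ∀ n, (∏ i ∈ range n, dualFactor 1 u p i).snd = _ :=
    snd_prod_of_eq_mul (g := fun i => -lambert (u + p * i)) fun i => by
      rw [fst_dualFactor, snd_dualFactor, mul_neg, one_sub_mul_lambert (by omega), one_mul]
  have e2 : ∀ n, (∏ i ∈ range n, dualFactor (-1) v p i).snd = _ :=
    snd_prod_of_eq_mul (g := fun i => lambert (v + p * i)) fun i => by
      rw [fst_dualFactor, snd_dualFactor, one_sub_mul_lambert (by omega)]; ring
  have e3 : ∀ n, ((∏ i ∈ range n, dualFactor 1 u p i) * ∏ i ∈ range n, dualFactor (-1) v p i).snd =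
      (∏ i ∈ range n, (1 + C (-1) * X ^ u * (X ^ p) ^ i)) *
      (∏ i ∈ range n, (1 + C (-1) * X ^ v * (X ^ p) ^ i)) *
      ∑ i ∈ range n, (lambert (v + p * i) - lambert (u + p * i)) := by
    intro n
    rw [snd_mul, e1, e2, fst_prod_dualFactor, fst_prod_dualFactor]
    simp only [fst_dualFactor, smul_eq_mul, op_smul_eq_smul, sum_neg_distrib,
      sum_sub_distrib, map_neg, map_one, neg_mul, one_mul, ← sub_eq_add_neg, ← pow_mul, ← pow_add]
    ring
  simp only [e3]
  have hs := ((summable_lambert v hp).sub (summable_lambert u hp)).hasSum.tendsto_sum_nat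
  have := ((tendsto_const_nhds (x := qTail p 0)).mul (((tendsto_prod_poch (-1) u hp).mul
    (tendsto_prod_poch (-1) v hp)).mul hs)).mul (tendsto_qTail_add_self hp)
  convert this using 2
  rw [qTail_zero]; ring

theorem hasSum_of_eq {ι : Type*} {f g : ι → ℝ⟦X⟧} {a : ℝ⟦X⟧} (h : HasSum f a)
    (e : ∀ j, g j = f j) : HasSum g a := by
  rwa [funext e]

/-- Jacobi's identity for the cube of Euler's product. -/
theorem jacobi_cube {p : ℕ} (hp : 0 < p) :
    HasSum (fun j : ℤ => (C ((-1) ^ j * (2 * j + 1 : ℝ)) * X ^ (p * tri j) : ℝ⟦X⟧))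
      (2 * qProd p ^ 3) := by
  have h0 := jacobi_triple_product (α := -1) (by norm_num) (u := p) (v := 0) hp rfl
  -- At v = 0 the factor with exponent 0 vanishes, so the triple product itself sums to 0. Adding
  -- this to twice the derivative turns the weight j into 2 j + 1.
  have hz : poch (-1)⁻¹ 0 p = 0 := by rw [poch_eq_mul _ _ hp]; norm_num
  rw [hz, mul_zero, zero_mul] at h0
  have h1 : HasSum (fun j : ℤ => (C ((-1) ^ j * (j : ℝ)) * X ^ jexp p 0 j : ℝ⟦X⟧)) (qProd p ^ 3) := by
    refine hasSum_theta_of_tendsto (by omega) (qTail p) (X_pow_dvd_qTail_sub_one hp)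
      (fun j => (-1) ^ j * (j : ℝ)) ?_
    refine Tendsto.congr (finite_triple_product_deriv hp rfl) ?_
    rw [← tendsto_add_atTop_iff_nat 1]
    have e : ∀ n, ((∏ i ∈ range (n + 1), dualFactor 1 p p i) *
        ∏ i ∈ range (n + 1), dualFactor (-1) 0 p i).snd =
        (∏ i ∈ range (n + 1), (1 + C (-1) * X ^ p * (X ^ p) ^ i)) *
        ∏ i ∈ range n, (1 + C (-1) * X ^ p * (X ^ p) ^ i) := by
      intro n
      -- The vanishing factor is 1 - (1 - ε) = ε, so the ε-part of the whole product is the ordinary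
      -- product of the other factors.
      have hd : dualFactor (-1) 0 p 0 = inr 1 := by
        ext1
        · simp [fst_dualFactor]
        · simp [snd_dualFactor]
      rw [prod_range_succ' (dualFactor (-1) 0 p), hd, ← mul_assoc, snd_mul, fst_mul,
        fst_prod_dualFactor, fst_prod]
      simp [fst_dualFactor, ← sub_eq_add_neg, ← pow_mul, ← pow_add, mul_add, add_comm]
    simp only [e]
    have := ((tendsto_const_nhds (x := qTail p 0)).mul
      (((tendsto_prod_poch (-1) p hp).comp (tendsto_add_atTop_nat 1)).mul
        (tendsto_prod_poch (-1) p hp))).mul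
      ((tendsto_qTail_add_self hp).comp (tendsto_add_atTop_nat 1))
    have e2 : qTail p 0 * (poch (-1) p p * poch (-1) p p) * 1 = qProd p ^ 3 := by
      rw [qTail_zero, qProd_eq_poch]; ring
    rw [e2] at this
    exact this
  have := (h1.mul_left 2).add h0
  rw [add_zero] at this
  refine hasSum_of_eq this fun j => ?_
  simp only [jexp, zero_mul, add_zero, map_mul, map_add, map_one, map_ofNat]
  ring

end DualNumbers

/-! ### Nonnegative coefficients and products over sets of parts -/

/-- All coefficients of the power series are nonnegative. -/
def CoeffNonneg (f : ℝ⟦X⟧) : Prop := ∀ n, 0 ≤ coeff n f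

theorem CoeffNonneg.one : CoeffNonneg 1 := fun n => by
  rw [coeff_one]; split <;> norm_num

theorem CoeffNonneg.X_pow (k : ℕ) : CoeffNonneg (X ^ k) := fun n => by
  rw [coeff_X_pow]; split <;> norm_num

theorem CoeffNonneg.add {f g : ℝ⟦X⟧} (hf : CoeffNonneg f) (hg : CoeffNonneg g) :
    CoeffNonneg (f + g) := fun n => by
  rw [map_add]; exact add_nonneg (hf n) (hg n)

theorem CoeffNonneg.mul {f g : ℝ⟦X⟧} (hf : CoeffNonneg f) (hg : CoeffNonneg g) :
    CoeffNonneg (f * g) := fun n => by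
  rw [coeff_mul]; exact sum_nonneg fun i _ => mul_nonneg (hf _) (hg _)

theorem CoeffNonneg.prod {ι : Type*} {f : ι → ℝ⟦X⟧} {s : Finset ι}
    (h : ∀ i ∈ s, CoeffNonneg (f i)) : CoeffNonneg (∏ i ∈ s, f i) :=
  prod_induction f CoeffNonneg (fun _ _ => .mul) .one h

theorem CoeffNonneg.pow {f : ℝ⟦X⟧} (hf : CoeffNonneg f) (k : ℕ) : CoeffNonneg (f ^ k) := by
  rw [← card_range k, ← prod_const]
  exact .prod fun _ _ => hf

theorem CoeffNonneg.of_tendsto {f : ℕ → ℝ⟦X⟧} {g : ℝ⟦X⟧} (h : Tendsto f atTop (𝓝 g))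
    (hf : ∀ n, CoeffNonneg (f n)) : CoeffNonneg g := fun d =>
  ge_of_tendsto' ((WithPiTopology.tendsto_iff_coeff_tendsto _ _ _ _).1 h d) fun n => hf n d

theorem CoeffNonneg.mul_coeff_le {f g : ℝ⟦X⟧} (hf : CoeffNonneg f) (hg : CoeffNonneg g)
    (i j : ℕ) : coeff i f * coeff j g ≤ coeff (i + j) (f * g) := by
  rw [coeff_mul]
  exact single_le_sum (f := fun x : ℕ × ℕ => coeff x.1 f * coeff x.2 g) (a := (i, j))
    (fun x _ => mul_nonneg (hf _) (hg _)) (by simp)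

theorem coeff_lambert {d : ℕ} (hd : 0 < d) (n : ℕ) :
    coeff n (lambert d) = if d ∣ n ∧ 0 < n then 1 else 0 := by
  have h : (1 - X ^ d) * (PowerSeries.mk fun n => if d ∣ n ∧ 0 < n then (1 : ℝ) else 0) = X ^ d := by
    ext n
    rw [sub_mul, one_mul, map_sub, coeff_X_pow_mul', coeff_mk, coeff_X_pow]
    by_cases h : d ≤ n
    · obtain ⟨k, rfl⟩ := Nat.exists_eq_add_of_le h
      rcases k.eq_zero_or_pos with rfl | hk
      · simp [hd]
      · have : d ∣ d + k ↔ d ∣ k := by simp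
        simp [this, hk, hk.ne']
    · have h1 : ¬ (d ∣ n ∧ 0 < n) := fun h' => h (Nat.le_of_dvd h'.2 h'.1)
      simp [h, h1, (not_le.1 h).ne]
  rw [← (isUnit_one_sub_X_pow hd).mul_left_cancel (h.trans (one_sub_mul_lambert hd).symm), coeff_mk]

theorem coeffNonneg_lambert {d : ℕ} (hd : 0 < d) : CoeffNonneg (lambert d) := fun n => by
  rw [coeff_lambert hd]; split <;> norm_num

theorem inv_one_sub_X_pow {d : ℕ} (hd : 0 < d) : (1 - X ^ d : ℝ⟦X⟧)⁻¹ = 1 + lambert d := by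
  have h : constantCoeff (1 - X ^ d : ℝ⟦X⟧) ≠ 0 := by simp [hd.ne']
  rw [PowerSeries.inv_eq_iff_mul_eq_one h, add_mul, mul_comm (lambert d), one_sub_mul_lambert hd]
  ring

theorem coeffNonneg_inv_one_sub_X_pow {d : ℕ} (hd : 0 < d) :
    CoeffNonneg (1 - X ^ d : ℝ⟦X⟧)⁻¹ := by
  rw [inv_one_sub_X_pow hd]; exact .add .one (coeffNonneg_lambert hd)

theorem coeff_inv_one_sub_X_pow {d : ℕ} (hd : 0 < d) {n : ℕ} (h : d ∣ n) :
    coeff n (1 - X ^ d : ℝ⟦X⟧)⁻¹ = 1 := by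
  rw [inv_one_sub_X_pow hd, map_add, coeff_one, coeff_lambert hd]
  rcases n.eq_zero_or_pos with rfl | hn
  · simp
  · simp [h, hn, hn.ne']

theorem coeffNonneg_poch {α : ℝ} (hα : 0 ≤ α) (u : ℕ) {p : ℕ} (hp : 0 < p) :
    CoeffNonneg (poch α u p) := by
  refine .of_tendsto (multipliable_poch α u hp).hasProd.tendsto_prod_nat fun n => .prod fun i _ =>
    .add .one fun d => ?_
  rw [coeff_C_mul]
  exact mul_nonneg hα (CoeffNonneg.X_pow _ d)

theorem coeff_zero_poch (α : ℝ) {u p : ℕ} (hu : 0 < u) (hp : 0 < p) :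
    coeff 0 (poch α u p) = 1 := by
  have := X_pow_dvd_iff.1 (X_pow_dvd_poch_sub_one α u hp) 0 hu
  rw [map_sub, coeff_zero_one] at this
  linarith

open Classical in
/-- The product of `1 - X ^ k` over the positive integers `k` in `U`. -/
def partProd (U : Set ℕ) : ℝ⟦X⟧ := ∏' n : ℕ, (if n + 1 ∈ U then 1 - X ^ (n + 1) else 1)

open Classical in
theorem multipliable_partProd (U : Set ℕ) :
    Multipliable fun n : ℕ => (if n + 1 ∈ U then 1 - X ^ (n + 1) else 1 : ℝ⟦X⟧) := by
  have : ∀ n : ℕ, (if n + 1 ∈ U then 1 - X ^ (n + 1) else 1 : ℝ⟦X⟧) =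
      1 + if n + 1 ∈ U then - X ^ (n + 1) else 0 := fun n => by split <;> ring
  simp only [this]
  refine multipliable_one_add_of_X_pow_dvd fun n => ?_
  split
  · exact (pow_dvd_pow _ (by omega)).neg_right
  · simp

theorem partProd_mul {U V W : Set ℕ} (hd : ∀ k, 0 < k → k ∈ U → k ∉ V)
    (h : ∀ k, 0 < k → (k ∈ W ↔ k ∈ U ∨ k ∈ V)) : partProd U * partProd V = partProd W := by
  classical
  rw [partProd, partProd, partProd,
    ← (multipliable_partProd U).tprod_mul (multipliable_partProd V)]
  congr 1 with n : 1
  have h1 := hd (n + 1) n.succ_pos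
  have h2 := h (n + 1) n.succ_pos
  by_cases hU : n + 1 ∈ U
  · simp [h2, hU, h1 hU]
  · simp [h2, hU]

theorem partProd_univ : partProd Set.univ = qProd 1 := by
  simp [partProd, qProd]

theorem partProd_singleton {k : ℕ} (hk : 0 < k) : partProd {k} = 1 - X ^ k := by
  obtain ⟨k, rfl⟩ := Nat.exists_eq_add_of_le' hk
  rw [partProd, tprod_eq_mulSingle k]
  · simp
  · intro n hn
    simp [hn]

theorem partProd_eq_mul {U : Set ℕ} {k : ℕ} (hk : 0 < k) (hU : k ∈ U) :
    partProd U = partProd (U \ {k}) * (1 - X ^ k) := by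
  rw [← partProd_singleton hk, partProd_mul]
  · intro n _ h
    exact h.2
  · intro n _
    by_cases h : n = k <;> simp [h, hU]

/-- The arithmetic progression `u, u + p, u + 2 p, …`. -/
def progression (u p : ℕ) : Set ℕ := {k | ∃ n, k = u + p * n}

theorem poch_eq_partProd {u p : ℕ} (hu : 0 < u) (hp : 0 < p) :
    poch (-1) u p = partProd (progression u p) := by
  classical
  rw [poch_neg_one, partProd]
  have hg : Function.Injective fun n => u + p * n - 1 := by
    intro a b h
    have h : u + p * a - 1 = u + p * b - 1 := h
    have : p * a = p * b := by omega
    exact Nat.eq_of_mul_eq_mul_left hp this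
  rw [← hg.tprod_eq (f := fun n : ℕ =>
    (if n + 1 ∈ progression u p then 1 - X ^ (n + 1) else 1 : ℝ⟦X⟧))]
  · congr 1 with n : 1
    have e : u + p * n - 1 + 1 = u + p * n := by omega
    rw [e, if_pos ⟨n, rfl⟩]
  · intro k hk
    simp only [Function.mem_mulSupport, ne_eq, ite_eq_right_iff, Classical.not_imp] at hk
    obtain ⟨n, hn⟩ := hk.1
    exact ⟨n, by simp only; omega⟩

theorem constantCoeff_partProd (U : Set ℕ) : constantCoeff (partProd U) = 1 := by
  classical
  rw [partProd, (multipliable_partProd U).map_tprod _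
    (WithPiTopology.continuous_constantCoeff ℝ)]
  simp [apply_ite]

theorem partProd_mul_inv (U : Set ℕ) : partProd U * (partProd U)⁻¹ = 1 :=
  PowerSeries.mul_inv_cancel _ (by rw [constantCoeff_partProd]; exact one_ne_zero)

theorem coeff_zero_inv_partProd (U : Set ℕ) : coeff 0 (partProd U)⁻¹ = 1 := by
  rw [coeff_zero_eq_constantCoeff, constantCoeff_inv, constantCoeff_partProd, inv_one]

/-- The reciprocal is a product of geometric series: it generates partitions with parts in `U`. -/
theorem coeffNonneg_inv_partProd (U : Set ℕ) : CoeffNonneg (partProd U)⁻¹ := by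
  classical
  have hm : Multipliable fun n : ℕ => (1 + if n + 1 ∈ U then lambert (n + 1) else 0 : ℝ⟦X⟧) := by
    refine multipliable_one_add_of_X_pow_dvd fun n => ?_
    split
    · exact (pow_dvd_pow _ (by omega)).mul_right _
    · simp
  have h1 : (∏' n : ℕ, (1 + if n + 1 ∈ U then lambert (n + 1) else 0 : ℝ⟦X⟧)) * partProd U = 1 := by
    rw [partProd, ← hm.tprod_mul (multipliable_partProd U)]
    convert tprod_one with n
    split
    · rw [← inv_one_sub_X_pow (by omega)]
      exact PowerSeries.inv_mul_cancel _ (by simp)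
    · simp
  rw [← (PowerSeries.eq_inv_iff_mul_eq_one (by rw [constantCoeff_partProd]; exact one_ne_zero)).2 h1]
  refine .of_tendsto hm.hasProd.tendsto_prod_nat fun n => .prod fun i _ => .add .one ?_
  split
  · exact coeffNonneg_lambert (by omega)
  · intro d; simp

theorem inv_partProd_eq_mul {U : Set ℕ} {k : ℕ} (hk : 0 < k) (hU : k ∈ U) :
    (partProd U)⁻¹ = (partProd (U \ {k}))⁻¹ * (1 - X ^ k)⁻¹ := by
  rw [partProd_eq_mul hk hU, PowerSeries.mul_inv_rev, mul_comm]

/-- Every n ≥ 2 has a partition with parts in `U`: all ones, or twos together with at most one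
three. -/
theorem one_le_coeff_inv_partProd {U : Set ℕ} (hU : 1 ∈ U ∨ 2 ∈ U ∧ 3 ∈ U) {n : ℕ} (hn : 2 ≤ n) :
    1 ≤ coeff n (partProd U)⁻¹ := by
  rcases hU with h | ⟨h2, h3⟩
  · rw [inv_partProd_eq_mul one_pos h]
    refine le_trans ?_ ((zero_add n) ▸ (coeffNonneg_inv_partProd _).mul_coeff_le
      (coeffNonneg_inv_one_sub_X_pow one_pos) 0 n)
    rw [coeff_zero_inv_partProd, coeff_inv_one_sub_X_pow one_pos (one_dvd _), mul_one]
  · rw [inv_partProd_eq_mul two_pos h2, inv_partProd_eq_mul (k := 3) (by norm_num) (by simp [h3]),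
      mul_assoc]
    have hn2 := coeffNonneg_inv_one_sub_X_pow (d := 2) (by norm_num)
    have hn3 := coeffNonneg_inv_one_sub_X_pow (d := 3) (by norm_num)
    refine le_trans ?_ ((zero_add n) ▸ (coeffNonneg_inv_partProd _).mul_coeff_le (hn3.mul hn2) 0 n)
    rw [coeff_zero_inv_partProd, one_mul]
    rcases Nat.even_or_odd' n with ⟨k, rfl | rfl⟩
    · refine le_trans ?_ ((zero_add (2 * k)) ▸ hn3.mul_coeff_le hn2 0 (2 * k))
      rw [coeff_inv_one_sub_X_pow (by norm_num) (by simp),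
        coeff_inv_one_sub_X_pow (by norm_num) (by simp), mul_one]
    · obtain ⟨k, rfl⟩ := Nat.exists_eq_add_of_le' (show 1 ≤ k by omega)
      rw [show 2 * (k + 1) + 1 = 3 + 2 * k by ring]
      refine le_trans ?_ (hn3.mul_coeff_le hn2 3 (2 * k))
      rw [coeff_inv_one_sub_X_pow (by norm_num) (by simp),
        coeff_inv_one_sub_X_pow (by norm_num) (by simp), mul_one]

theorem coeff_pos_of_mul_partProd {U : Set ℕ} (hU : 1 ∈ U ∨ 2 ∈ U ∧ 3 ∈ U) {f g : ℝ⟦X⟧}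
    (h : f * partProd U = g) (hg : CoeffNonneg g) (hg0 : 0 < coeff 0 g) {n : ℕ} (hn : 2 ≤ n) :
    0 < coeff n f := by
  have : f = g * (partProd U)⁻¹ := by rw [← h, mul_assoc, partProd_mul_inv, mul_one]
  rw [this]
  refine lt_of_lt_of_le ?_ ((zero_add n) ▸ hg.mul_coeff_le (coeffNonneg_inv_partProd U) 0 n)
  have := one_le_coeff_inv_partProd hU hn
  positivity

/-! ### Dissection into residue classes and the reduction to signs per class -/

/-- The series whose `n`-th coefficient is the coefficient of `f` at `p n + r`. -/
def comp (p r : ℕ) (f : ℝ⟦X⟧) : ℝ⟦X⟧ := PowerSeries.mk fun n => coeff (p * n + r) f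

theorem coeff_comp (p r n : ℕ) (f : ℝ⟦X⟧) : coeff n (comp p r f) = coeff (p * n + r) f :=
  coeff_mk _ _

theorem comp_C_mul (p r : ℕ) (a : ℝ) (f : ℝ⟦X⟧) : comp p r (C a * f) = C a * comp p r f := by
  ext n
  simp [coeff_comp]

theorem comp_X_pow {p r : ℕ} (hr : r < p) (e : ℕ) :
    comp p r (X ^ e) = if e % p = r then X ^ (e / p) else 0 := by
  ext n
  rw [coeff_comp, coeff_X_pow]
  have h := Nat.div_add_mod e p
  split_ifs with h1 h2 h2
  · rw [coeff_X_pow, if_pos]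
    rw [← h1, Nat.mul_add_div (by omega), Nat.div_eq_of_lt hr, add_zero]
  · rw [← h1, Nat.mul_add_mod, Nat.mod_eq_of_lt hr] at h2
    exact absurd rfl h2
  · rw [coeff_X_pow, if_neg]
    rintro rfl
    exact h1 (by rw [← h2, h])
  · simp

/-- Multiplying by a series in q^p does not mix residue classes, so extraction of a class is linear
over such series. -/
theorem comp_mul_expand {p r : ℕ} (hr : r < p) (f g : ℝ⟦X⟧) :
    comp p r (f * expand p (by omega) g) = comp p r f * g := by
  ext n
  rw [coeff_comp, coeff_mul, coeff_mul]
  symm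
  have hp : 0 < p := by omega
  refine Finset.sum_of_injOn (fun x => (p * x.1 + r, p * x.2)) ?_ ?_ ?_ ?_
  · rintro ⟨a, b⟩ _ ⟨a', b'⟩ _ h
    simp only [Prod.mk.injEq, add_left_inj, mul_eq_mul_left_iff, hp.ne', or_false] at h ⊢
    exact h
  · rintro ⟨a, b⟩ h
    simp only [mem_coe, HasAntidiagonal.mem_antidiagonal] at h ⊢
    rw [← h]; ring
  · rintro ⟨a, b⟩ h h'
    simp only [HasAntidiagonal.mem_antidiagonal] at h
    rw [coeff_expand_of_not_dvd, mul_zero]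
    rintro ⟨b', rfl⟩
    apply h'
    have hb : b' ≤ n := by
      by_contra! hc
      nlinarith
    refine ⟨(n - b', b'), by simp [hb], ?_⟩
    obtain ⟨k, rfl⟩ := Nat.exists_eq_add_of_le' hb
    simp only [Prod.mk.injEq, and_true]
    rw [Nat.add_sub_cancel]; nlinarith
  · rintro ⟨a, b⟩ h
    rw [coeff_comp, coeff_expand_mul]

theorem hasSum_comp {ι : Type*} {f : ι → ℝ⟦X⟧} {a : ℝ⟦X⟧} (h : HasSum f a) (p r : ℕ) :
    HasSum (fun i => comp p r (f i)) (comp p r a) := by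
  rw [WithPiTopology.hasSum_iff_hasSum_coeff] at h ⊢
  intro d
  simpa only [coeff_comp] using h (p * d + r)

theorem continuous_of_continuous_coeff {g : ℝ⟦X⟧ → ℝ⟦X⟧}
    (h : ∀ d, Continuous fun f => coeff d (g f)) : Continuous g := by
  rw [continuous_iff_continuousAt]
  intro f
  exact (WithPiTopology.tendsto_iff_coeff_tendsto _ _ _ _).2 fun d => (h d).continuousAt

theorem continuous_expand {p : ℕ} (hp : p ≠ 0) : Continuous (expand p hp (R := ℝ)) :=
  continuous_of_continuous_coeff fun d => by
    simp only [coeff_expand]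
    split_ifs
    · exact WithPiTopology.continuous_coeff ℝ _
    · exact continuous_const

theorem expand_qProd {p t : ℕ} (hp : p ≠ 0) (ht : 0 < t) :
    expand p hp (qProd t) = qProd (p * t) := by
  rw [qProd, (multipliable_qProd t ht).map_tprod _ (continuous_expand hp), qProd]
  congr 1 with n : 1
  simp [← pow_mul, mul_assoc]

theorem qProd_ne_zero {t : ℕ} (ht : 0 < t) : qProd t ≠ 0 := fun h => by
  have := constantCoeff_qProd t ht
  simp [h] at this

/-- The basic reduction: E(q^p) is the expansion of E(q), so it leaves the extraction as E(q). -/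
theorem comp_borweinProduct_pow {p r : ℕ} (hr : r < p) (m : ℕ) :
    comp p r (borweinProduct p ^ m) * qProd 1 ^ m = comp p r (qProd 1 ^ m) := by
  rw [← comp_mul_expand hr, map_pow, expand_qProd _ one_pos, ← mul_pow, mul_one,
    borweinProduct_mul_qProd p (by omega)]

/-- Constant signs on the classes make p a period. The remainder of p by the least period would be a
smaller period, so the least period is 1 or p, and two classes of different sign exclude 1. -/
theorem signConjecture_of_eventually_sign {p m : ℕ} (hp : p.Prime)
    (h : ∀ r < p, ∃ τ, ∀ᶠ n in atTop, SignType.sign (c p m (p * n + r)) = τ)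
    {r₁ r₂ : ℕ} {τ₁ τ₂ : SignType} (hτ : τ₁ ≠ τ₂)
    (h₁ : ∀ᶠ n in atTop, SignType.sign (c p m (p * n + r₁)) = τ₁)
    (h₂ : ∀ᶠ n in atTop, SignType.sign (c p m (p * n + r₂)) = τ₂) : SignConjecture p m := by
  set a := c p m
  have hper : IsPeriodOfSign a p := by
    refine ⟨hp.pos, ?_⟩
    have : ∀ r : Fin p, ∀ᶠ n in atTop,
        SignType.sign (a (p * n + r)) = SignType.sign (a (p * (n + 1) + r)) := by
      intro r
      obtain ⟨τ, hτ⟩ := h r r.2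
      filter_upwards [hτ, (tendsto_add_atTop_nat 1).eventually hτ] with n h1 h2
      rw [h1, h2]
    obtain ⟨N, hN⟩ := eventually_atTop.1 (eventually_all.2 this)
    refine ⟨p * N, fun n hn => ?_⟩
    have := hN (n / p) ((Nat.le_div_iff_mul_le hp.pos).2 (by linarith)) ⟨n % p, Nat.mod_lt _ hp.pos⟩
    simp only [Nat.div_add_mod, mul_add, mul_one] at this
    rw [this]
    congr 2
    have := Nat.div_add_mod n p
    omega
  have hex : ∃ s, IsPeriodOfSign a s := ⟨p, hper⟩
  refine ⟨hex, ?_⟩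
  classical
  have hleast : IsLeast {s' | IsPeriodOfSign a s'} (Nat.find hex) :=
    ⟨Nat.find_spec hex, fun s hs => Nat.find_min' hex hs⟩
  set s := Nat.find hex
  refine ⟨s, hleast, ?_⟩
  obtain ⟨hs, N, hN⟩ := hleast.1
  have hmul : ∀ k n, N ≤ n → SignType.sign (a n) = SignType.sign (a (n + s * k)) := by
    intro k n hn
    induction k with
    | zero => rfl
    | succ k ih => rw [ih, hN _ (by omega), mul_add, mul_one, add_assoc]
  obtain ⟨_, N', hN'⟩ := hper
  have hdvd : s ∣ p := by
    by_contra hc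
    have hlt : p % s < s := Nat.mod_lt _ hs
    have : IsPeriodOfSign a (p % s) := by
      refine ⟨Nat.pos_of_ne_zero fun h0 => hc (Nat.dvd_of_mod_eq_zero h0), max N N', fun n hn => ?_⟩
      rw [hmul (p / s) (n + p % s) (by omega), hN' n (by omega), add_assoc, Nat.mod_add_div]
    exact absurd (hleast.2 this) (by omega)
  rcases (Nat.dvd_prime hp).1 hdvd with h1 | h1
  · exfalso
    -- If 1 were a period, the terms at p M + r₁ and p M + r₂ would both have the sign of the term
    -- at p M.
    obtain ⟨M, hM⟩ := ((h₁.and h₂).and (eventually_ge_atTop N)).exists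
    rw [h1] at hmul
    have hpM : N ≤ p * M := by nlinarith [hp.pos]
    apply hτ
    rw [← hM.1.1, ← hM.1.2, ← one_mul r₁, ← one_mul r₂, ← hmul _ _ hpM, ← hmul _ _ hpM]
  · rw [h1]

/-- The final positivity argument in every case with odd p: the constant term of `g` times the
partition count already makes the coefficients of g / `partProd U` positive from degree 2 on. -/
theorem eventually_sign_of_mul_partProd {U : Set ℕ} (hU : 1 ∈ U ∨ 2 ∈ U ∧ 3 ∈ U) {f g : ℝ⟦X⟧}
    {ε : ℝ} {s : ℕ} (h : f * partProd U = C ε * X ^ s * g) (hg : CoeffNonneg g)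
    (hg0 : 0 < coeff 0 g) : ∀ᶠ n in atTop, SignType.sign (coeff n f) = SignType.sign ε := by
  have h1 : f = C ε * (X ^ s * (g * (partProd U)⁻¹)) := by
    rw [← mul_assoc, ← mul_assoc, ← h, mul_assoc, partProd_mul_inv, mul_one]
  filter_upwards [eventually_ge_atTop (s + 2)] with n hn
  have h2 : 0 < coeff (n - s) (g * (partProd U)⁻¹) :=
    coeff_pos_of_mul_partProd hU (by rw [mul_assoc, mul_comm _ (partProd U), partProd_mul_inv,
      mul_one]) hg hg0 (by omega)
  rw [h1, coeff_C_mul, coeff_X_pow_mul', if_pos (by omega), sign_mul, sign_pos h2, mul_one]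

/-! ### The case t = 2 -/

theorem continuous_rescale (a : ℝ) : Continuous (rescale a) :=
  continuous_of_continuous_coeff fun d => by
    simp only [coeff_rescale]
    exact continuous_const.mul (WithPiTopology.continuous_coeff ℝ d)

/-- Only odd exponents survive in (q;q)_∞ / (q²;q²)_∞, so q ↦ -q turns every minus sign into a plus.
-/
theorem borweinProduct_two : borweinProduct 2 = rescale (-1) (poch 1 1 2) := by
  have h1 : borweinProduct 2 = poch (-1) 1 2 := by
    apply mul_right_cancel₀ (qProd_ne_zero two_pos)
    rw [borweinProduct_mul_qProd 2 two_pos, qProd_eq_poch 2, poch_eq_partProd one_pos two_pos,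
      poch_eq_partProd two_pos two_pos, ← partProd_univ]
    refine (partProd_mul ?_ ?_).symm
    · rintro k - ⟨n, rfl⟩ ⟨n', hn⟩
      omega
    · intro k hk
      simp only [Set.mem_univ, true_iff]
      rcases Nat.even_or_odd' k with ⟨j, rfl | rfl⟩
      · exact Or.inr ⟨j - 1, by omega⟩
      · exact Or.inl ⟨j, by omega⟩
  rw [h1, poch, poch, (multipliable_poch 1 1 two_pos).map_tprod _ (continuous_rescale (-1))]
  congr 1 with n : 1
  have : (-X : ℝ⟦X⟧) ^ (1 + 2 * n) = -X ^ (1 + 2 * n) := Odd.neg_pow ⟨n, by ring⟩ X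
  simp [this]

/-- The coefficients count partitions into distinct odd parts: n itself if n is odd, (n - 1) + 1 if
n ≥ 4 is even. The number 2 has none. -/
theorem one_le_coeff_poch_one_one_two {n : ℕ} (hn : 3 ≤ n) : 1 ≤ coeff n (poch 1 1 2) := by
  have h := (WithPiTopology.tendsto_iff_coeff_tendsto _ _ _ _).1
    (multipliable_poch 1 1 two_pos).hasProd.tendsto_prod_nat n
  set f : ℕ → ℝ⟦X⟧ := fun k => ∏ i ∈ range k, (1 + C 1 * X ^ (1 + 2 * i)) with hf
  have hs : ∀ k, f (k + 1) = f k + f k * X ^ (1 + 2 * k) := fun k => by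
    rw [hf]
    simp only [prod_range_succ, map_one, one_mul]
    ring
  have hnn : ∀ k, CoeffNonneg (f k) := fun k => .prod fun i _ => by
    simpa using CoeffNonneg.one.add (.X_pow _)
  have hmono : ∀ d, Monotone fun k => coeff d (f k) := fun d => monotone_nat_of_le_succ fun k => by
    rw [hs, map_add]
    exact le_add_of_nonneg_right ((hnn k).mul (.X_pow _) d)
  have hstep : ∀ k d, coeff d (f k) ≤ coeff (d + (1 + 2 * k)) (f (k + 1)) := fun k d => by
    rw [hs, map_add, coeff_mul_X_pow]
    exact le_add_of_nonneg_left (hnn k _)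
  have h0 : ∀ k, 1 ≤ coeff 0 (f k) := fun k => by
    have := hmono 0 (Nat.zero_le k)
    simp [hf] at this ⊢
  have hk : ∃ k, 1 ≤ coeff n (f k) := by
    rcases Nat.even_or_odd' n with ⟨j, rfl | rfl⟩
    · obtain ⟨k, rfl⟩ := Nat.exists_eq_add_of_le' (show 2 ≤ j by omega)
      refine ⟨k + 1 + 1, le_trans ?_ (le_trans (hmono 1 (show 1 ≤ k + 1 by omega)) ?_)⟩
      · simp [hf, coeff_X]
      · have := hstep (k + 1) 1
        rwa [show 1 + (1 + 2 * (k + 1)) = 2 * (k + 2) by ring] at this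
    · have := hstep j 0
      rw [show 0 + (1 + 2 * j) = 2 * j + 1 by ring] at this
      exact ⟨j + 1, (h0 j).trans this⟩
  obtain ⟨k, hk⟩ := hk
  refine ge_of_tendsto h ?_
  filter_upwards [eventually_ge_atTop k] with K hK
  exact hk.trans (hmono n hK)

theorem signConjecture_two {m : ℕ} (hm : 0 < m) : SignConjecture 2 m := by
  have hpos : ∀ n, 3 ≤ n → 0 < coeff n (poch 1 1 2 ^ m) := by
    intro n hn
    obtain ⟨k, rfl⟩ := Nat.exists_eq_add_of_le' hm
    have hk : CoeffNonneg (poch 1 1 2) := coeffNonneg_poch zero_le_one 1 two_pos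
    have hk' : CoeffNonneg (poch 1 1 2 ^ k) := hk.pow k
    rw [pow_succ]
    refine lt_of_lt_of_le ?_ ((zero_add n) ▸ hk'.mul_coeff_le hk 0 n)
    have := one_le_coeff_poch_one_one_two hn
    rw [coeff_zero_eq_constantCoeff, map_pow, ← coeff_zero_eq_constantCoeff,
      coeff_zero_poch 1 one_pos two_pos, one_pow]
    linarith
  have hc : ∀ n, c 2 m n = (-1) ^ n * coeff n (poch 1 1 2 ^ m) := fun n => by
    rw [c, borweinProduct_two, ← map_pow, coeff_rescale]
  have h0 : ∀ᶠ n in atTop, SignType.sign (c 2 m (2 * n + 0)) = 1 := by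
    filter_upwards [eventually_ge_atTop 2] with n hn
    rw [hc, sign_mul, sign_pos (hpos _ (by omega))]
    simp
  have h1 : ∀ᶠ n in atTop, SignType.sign (c 2 m (2 * n + 1)) = -1 := by
    filter_upwards [eventually_ge_atTop 2] with n hn
    rw [hc, sign_mul, sign_pos (hpos _ (by omega)), pow_succ]
    simp
  refine signConjecture_of_eventually_sign Nat.prime_two (fun r hr => ?_) (by decide) h0 h1
  interval_cases r
  · exact ⟨_, h0⟩
  · exact ⟨_, h1⟩

/-! ### The case m = 3, p odd -/

theorem coeff_zero_mul (f g : ℝ⟦X⟧) : coeff 0 (f * g) = coeff 0 f * coeff 0 g := by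
  simp only [coeff_zero_eq_constantCoeff, map_mul]

theorem coeff_lambert_mul_inv_one_sub_X {d : ℕ} (hd : 0 < d) (n : ℕ) :
    coeff n (lambert d * (1 - X ^ 1 : ℝ⟦X⟧)⁻¹) = ((n / d : ℕ) : ℝ) := by
  rw [coeff_mul, Finset.Nat.sum_antidiagonal_eq_sum_range_succ_mk, ← Nat.Ioc_filter_dvd_card_eq_div]
  simp only [coeff_inv_one_sub_X_pow one_pos (one_dvd _), mul_one, coeff_lambert hd]
  rw [sum_boole]
  congr 2
  ext i
  simp only [mem_filter, Finset.mem_range, Finset.mem_Ioc]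
  omega

/-- The difference itself has coefficients of both signs. Division by 1 - q takes partial sums,
which are ⌊n/d⌋ - ⌊n/e⌋ ≥ 0. -/
theorem coeffNonneg_lambert_sub_lambert {d e : ℕ} (hd : 0 < d) (h : d ≤ e) :
    CoeffNonneg ((lambert d - lambert e) * (1 - X ^ 1)⁻¹) := fun n => by
  rw [sub_mul, map_sub, coeff_lambert_mul_inv_one_sub_X hd,
    coeff_lambert_mul_inv_one_sub_X (by omega), sub_nonneg]
  exact_mod_cast Nat.div_le_div_left h hd

theorem coeffNonneg_tsum_lambert {u v p : ℕ} (hp : 0 < p) (hv : 0 < v) (h : v ≤ u) :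
    CoeffNonneg ((∑' n : ℕ, (lambert (v + p * n) - lambert (u + p * n))) * (1 - X ^ 1)⁻¹) := by
  have hs := ((summable_lambert v hp).sub (summable_lambert u hp)).hasSum.tendsto_sum_nat
  refine .of_tendsto (hs.mul_const ((1 - X ^ 1)⁻¹)) fun n => ?_
  rw [sum_mul]
  intro d
  rw [map_sum]
  exact sum_nonneg fun i _ => coeffNonneg_lambert_sub_lambert (by omega) (by omega) d

theorem hasSum_indicator_range {ι κ : Type*} {g : ι → κ} (hg : Function.Injective g)
    {f : κ → ℝ⟦X⟧} {a : ℝ⟦X⟧} (h : HasSum (fun s => f (g s)) a) :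
    HasSum (Set.indicator (Set.range g) f) a := by
  rw [← hg.hasSum_iff]
  · exact hasSum_of_eq h fun s => by simp
  · intro x hx; simp [hx]

theorem hasSum_of_two_injective {ι κ : Type*} {g g' : ι → κ} (hg : Function.Injective g)
    (hg' : Function.Injective g') (hd : ∀ s t, g s ≠ g' t) {f : κ → ℝ⟦X⟧}
    (hf : ∀ k, (∀ s, k ≠ g s) → (∀ s, k ≠ g' s) → f k = 0) {a a' : ℝ⟦X⟧}
    (h : HasSum (fun s => f (g s)) a) (h' : HasSum (fun s => f (g' s)) a') :
    HasSum f (a + a') := by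
  refine hasSum_of_eq ((hasSum_indicator_range hg h).add (hasSum_indicator_range hg' h'))
    fun k => ?_
  by_cases hk : k ∈ Set.range g
  · have : k ∉ Set.range g' := by
      obtain ⟨s, rfl⟩ := hk
      rintro ⟨t, ht⟩
      exact hd s t ht.symm
    simp [hk, this]
  · by_cases hk' : k ∈ Set.range g'
    · simp [hk, hk']
    · simp only [hk, hk', not_false_eq_true, Set.indicator_of_notMem, add_zero]
      exact hf k (fun s e => hk ⟨s, e.symm⟩) (fun s e => hk' ⟨s, e.symm⟩)

theorem hasSum_comp_cube {p r : ℕ} (hr : r < p) :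
    HasSum (fun k : ℤ => C ((-1) ^ k * (2 * k + 1 : ℝ)) *
      (if tri k % p = r then X ^ (tri k / p) else 0)) (2 * comp p r (qProd 1 ^ 3)) := by
  have h := hasSum_comp (jacobi_cube one_pos) p r
  rw [show (2 : ℝ⟦X⟧) = C 2 from (map_ofNat C 2).symm, comp_C_mul] at h
  rw [show (2 : ℝ⟦X⟧) = C 2 from (map_ofNat C 2).symm]
  exact hasSum_of_eq h fun k => by rw [comp_C_mul, one_mul, comp_X_pow hr]

theorem eq_of_two_mul_eq {a b : ℝ⟦X⟧} (h : 2 * a = 2 * b) : a = b :=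
  mul_left_cancel₀ (fun h0 => by simpa [map_ofNat] using congrArg constantCoeff h0) h

/-- Twice the difference of the triangular numbers is (k - l)(k + l + 1). A class therefore consists
of a progression mod p and its image under k ↦ -1 - k. -/
theorem tri_mod_eq_iff {p : ℕ} (hp : p.Prime) (h2 : p ≠ 2) (k l : ℤ) :
    tri k % p = tri l % p ↔ (p : ℤ) ∣ k - l ∨ (p : ℤ) ∣ k + l + 1 := by
  have hp' : Prime (p : ℤ) := Nat.prime_iff_prime_int.1 hp
  have h2' : ¬ (p : ℤ) ∣ 2 := by
    intro h
    have : p ∣ 2 := by exact_mod_cast h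
    exact h2 ((Nat.prime_dvd_prime_iff_eq hp Nat.prime_two).1 this)
  rw [← hp'.dvd_mul]
  have e : (k - l) * (k + l + 1) = (tri k - tri l) * 2 := by
    have h1 := tri_cast k
    have h2 := tri_cast l
    linear_combination h2 - h1
  rw [e, hp'.dvd_mul, or_iff_left h2']
  change tri k ≡ tri l [MOD p] ↔ _
  rw [Nat.ModEq.comm, Nat.modEq_iff_dvd]

theorem neg_one_zpow_add_mul {p : ℕ} (hp : Odd p) (κ s : ℤ) :
    (-1 : ℝ) ^ (κ + p * s) = (-1) ^ κ * (-1) ^ s := by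
  rw [zpow_add₀ (by norm_num), zpow_mul, zpow_natCast, hp.neg_one_pow]

theorem partProd_compl_mul {A B D : Set ℕ} (hAB : ∀ k ∈ A, k ∉ B) (hAD : ∀ k ∈ A, k ∉ D)
    (hBD : ∀ k ∈ B, k ∉ D) : partProd {k | k ∉ A ∧ k ∉ B ∧ k ∉ D} *
      (partProd A * partProd B * partProd D) = qProd 1 := by
  rw [partProd_mul (W := A ∪ B), partProd_mul (W := A ∪ B ∪ D), partProd_mul (W := Set.univ),
    partProd_univ]
  · rintro k _ ⟨h1, h2, h3⟩ ((h | h) | h) <;> contradiction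
  · intro k _
    simp only [Set.mem_univ, true_iff, Set.mem_ofPred_eq, Set.mem_union]
    tauto
  · rintro k _ (h | h)
    · exact hAD k h
    · exact hBD k h
  · intro k _; rfl
  · intro k _; exact hAB k
  · intro k _; rfl

theorem notMem_progression_of_not_dvd {p u v : ℕ} (h : ¬ (p : ℤ) ∣ u - v) :
    ∀ k ∈ progression u p, k ∉ progression v p := by
  rintro k ⟨n, rfl⟩ ⟨n', hn⟩
  have : (u : ℤ) + p * n = v + p * n' := by exact_mod_cast hn
  exact h ⟨n' - n, by linear_combination this⟩

theorem partProd_compl_mul_poch {p u v : ℕ} (hp : 0 < p) (hu : 0 < u) (hv : 0 < v)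
    (huv : ¬ (p : ℤ) ∣ u - v) (hup : ¬ p ∣ u) (hvp : ¬ p ∣ v) :
    partProd {k | k ∉ progression u p ∧ k ∉ progression v p ∧ k ∉ progression p p} *
      (poch (-1) u p * poch (-1) v p * qProd p) = qProd 1 := by
  rw [qProd_eq_poch p, poch_eq_partProd hu hp, poch_eq_partProd hv hp, poch_eq_partProd hp hp]
  have h : ∀ u : ℕ, ¬ p ∣ u → ¬ (p : ℤ) ∣ u - p := fun u hu h =>
    hu (by exact_mod_cast (dvd_sub_self_right.1 h))
  exact partProd_compl_mul (notMem_progression_of_not_dvd huv)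
    (notMem_progression_of_not_dvd (h u hup)) (notMem_progression_of_not_dvd (h v hvp))

theorem partProd_not_dvd_mul {p : ℕ} (hp : 0 < p) :
    partProd {k | ¬ p ∣ k} * qProd p = qProd 1 := by
  rw [qProd_eq_poch p, poch_eq_partProd hp hp, partProd_mul (W := Set.univ), partProd_univ]
  · rintro k _ h ⟨n, rfl⟩
    exact h ⟨1 + n, by ring⟩
  · intro k hk
    simp only [Set.mem_univ, true_iff, Set.mem_ofPred_eq]
    by_cases h : p ∣ k
    · obtain ⟨n, rfl⟩ := h
      refine Or.inr ⟨n - 1, ?_⟩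
      obtain ⟨n, rfl⟩ := Nat.exists_eq_add_of_le' (Nat.pos_of_mul_pos_left hk)
      rw [Nat.add_sub_cancel]; ring
    · exact Or.inl h

/-- This is the class fixed by the reflection: k = κ + p s gives 2 k + 1 = p (2 s + 1), so Jacobi's
cube series reappears in q^p. -/
theorem comp_cube_of_two_mul_add_one_eq {p r κ : ℕ} (hp : p.Prime) (h2 : p ≠ 2) (hr : r < p)
    (hκ : 2 * κ + 1 = p) (hκr : tri κ % p = r) :
    comp p r (qProd 1 ^ 3) = C ((-1) ^ κ * (p : ℝ)) * X ^ (tri κ / p) * qProd p ^ 3 := by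
  have hodd : Odd p := hp.odd_of_ne_two h2
  have h := hasSum_comp_cube hr
  have hg : Function.Injective fun s : ℤ => (κ : ℤ) + p * s := fun a b hab => by
    simpa [hp.ne_zero] using hab
  rw [← hg.hasSum_iff] at h
  · apply eq_of_two_mul_eq
    refine h.unique ?_
    have h3 := (jacobi_cube hp.pos).mul_left (C ((-1) ^ κ * (p : ℝ)) * X ^ (tri κ / p))
    rw [mul_left_comm]
    refine hasSum_of_eq h3 fun s => ?_
    have e : tri (κ + p * s) = tri κ + p * (p * tri s) := by
      zify
      apply mul_right_cancel₀ (two_ne_zero (α := ℤ))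
      have t1 := tri_cast (κ + p * s)
      have t2 := tri_cast κ
      have t3 := tri_cast s
      have hκ' : (2 * κ + 1 : ℤ) = p := by exact_mod_cast hκ
      linear_combination t1 - t2 - p ^ 2 * t3 + p * s * hκ'
    have hκ' : (2 * κ + 1 : ℝ) = p := by exact_mod_cast hκ
    have e3 : (-1 : ℝ) ^ ((κ : ℤ) + p * s) * (2 * ((κ + p * s : ℤ) : ℝ) + 1) =
        ((-1) ^ κ * p) * ((-1) ^ s * (2 * s + 1)) := by
      rw [neg_one_zpow_add_mul hodd, zpow_natCast]
      push_cast
      linear_combination (-1) ^ κ * (-1) ^ s * hκ'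
    simp only [Function.comp]
    rw [e3, e, Nat.add_mul_mod_self_left, if_pos hκr, Nat.add_mul_div_left _ _ hp.pos, pow_add,
      map_mul]
    ring
  · intro k hk
    rw [if_neg, mul_zero]
    intro hk'
    rw [← hκr, tri_mod_eq_iff hp h2] at hk'
    apply hk
    rcases hk' with ⟨s, hs⟩ | ⟨s, hs⟩
    · exact ⟨s, by simp only; linarith⟩
    · refine ⟨s - 1, ?_⟩
      have hκ' : (2 * κ + 1 : ℤ) = p := by exact_mod_cast hκ
      simp only
      linear_combination -hs + hκ'

/-- For k = κ + p s the weight 2 k + 1 is (2 κ + 1) + 2 p s: a triple product plus a multiple of its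
derivative, with u - v = 2 κ + 1 and u + v = p. The reflected progression contributes the same again
and absorbs the factor 2. -/
theorem comp_cube_of_two_mul_add_one_lt {p r κ u v : ℕ} (hp : p.Prime) (h2 : p ≠ 2) (hr : r < p)
    (hv : 0 < v) (hu : u = v + (2 * κ + 1)) (huv : u + v = p) (hκr : tri κ % p = r) :
    comp p r (qProd 1 ^ 3) = C ((-1) ^ κ) * X ^ (tri κ / p) *
      ((poch (-1) u p * poch (-1) v p * qProd p) * (C (2 * κ + 1 : ℝ) +
      C (2 * p : ℝ) * ∑' n : ℕ, (lambert (v + p * n) - lambert (u + p * n)))) := by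
  have hodd : Odd p := hp.odd_of_ne_two h2
  have h := hasSum_comp_cube hr
  have h1 : HasSum (fun s : ℤ => (C ((-1) ^ s) * X ^ jexp u v s : ℝ⟦X⟧))
      (poch (-1) u p * poch (-1) v p * qProd p) := by
    have := jacobi_triple_product (α := -1) (by norm_num) hp.pos huv
    rwa [show (-1 : ℝ)⁻¹ = -1 by norm_num] at this
  have h3 := jacobi_triple_product_deriv (by omega) hv huv
  have h4 := (((h1.mul_left (C (2 * κ + 1 : ℝ))).add (h3.mul_left (C (2 * p : ℝ)))).mul_left
    (C ((-1) ^ κ) * X ^ (tri κ / p)))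
  have e : ∀ s : ℤ, tri (κ + p * s) = tri κ + p * jexp u v s := fun s => by
    zify
    apply mul_right_cancel₀ (two_ne_zero (α := ℤ))
    have t1 := tri_cast (κ + p * s)
    have t2 := tri_cast κ
    have t3 := jexp_cast u v s
    subst huv hu
    push_cast at *
    linear_combination t1 - t2 - (2 * v + (2 * κ + 1)) * t3
  have e' : ∀ k : ℤ, tri (-1 - k) = tri k := fun k => by
    zify
    apply mul_right_cancel₀ (two_ne_zero (α := ℤ))
    linear_combination tri_cast (-1 - k) - tri_cast k
  set f : ℤ → ℝ⟦X⟧ := fun k => C ((-1) ^ k * (2 * k + 1 : ℝ)) *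
      (if tri k % p = r then X ^ (tri k / p) else 0) with hf
  have f' : ∀ k, f (-1 - k) = f k := fun k => by
    simp only [hf, e']
    congr 2
    rw [zpow_sub₀ (by norm_num), div_eq_mul_inv, ← inv_zpow, inv_neg_one]
    push_cast
    ring
  have h5 := hasSum_of_eq (g := fun s => f (κ + p * s)) h4 fun s => by
    simp only [hf, e, Nat.add_mul_mod_self_left, if_pos hκr, Nat.add_mul_div_left _ _ hp.pos,
      pow_add, neg_one_zpow_add_mul hodd, zpow_natCast]
    push_cast
    simp only [map_mul, map_add, map_one, map_ofNat]
    ring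
  have h6 := hasSum_of_eq (g := fun s => f (-1 - (κ + p * s))) h5 fun s => f' _
  have h7 := hasSum_of_two_injective (f := f) (fun a b hab => by simpa [hp.ne_zero] using hab)
    (fun a b hab => by simpa [hp.ne_zero] using hab) (fun s t hst => ?_) (fun k hk hk' => ?_) h5 h6
  · apply eq_of_two_mul_eq
    rw [h.unique h7]
    ring
  -- A common element of the two progressions would force p to divide 2 κ + 1, which is positive and
  -- less than p.
  · have : (p : ℤ) ∣ 2 * κ + 1 := ⟨-s - t, by linear_combination hst⟩
    have := Int.le_of_dvd (by positivity) this
    omega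
  · simp only [hf]
    rw [if_neg, mul_zero]
    intro hkr
    rw [← hκr, tri_mod_eq_iff hp h2] at hkr
    rcases hkr with ⟨s, hs⟩ | ⟨s, hs⟩
    · exact hk s (by linarith)
    · exact hk' (-s) (by linarith)

/-- Since 8 j (j + 1) / 2 + 1 = (2 j + 1)², a nonsquare a yields the missed residue (a - 1) / 8. -/
theorem exists_forall_tri_mod_ne {p : ℕ} (hp : p.Prime) (h2 : p ≠ 2) :
    ∃ r < p, ∀ k : ℤ, tri k % p ≠ r := by
  have := Fact.mk hp
  have h8 : (8 : ZMod p) ≠ 0 := by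
    have : (2 : ZMod p) ≠ 0 := by
      intro h
      have h' : p ∣ 2 := (ZMod.natCast_eq_zero_iff 2 p).1 (by exact_mod_cast h)
      exact h2 ((Nat.prime_dvd_prime_iff_eq hp Nat.prime_two).1 h')
    rw [show (8 : ZMod p) = 2 ^ 3 by norm_num]
    exact pow_ne_zero _ this
  obtain ⟨a, ha⟩ := FiniteField.exists_nonsquare (F := ZMod p) (by rwa [ZMod.ringChar_zmod_n])
  refine ⟨((a - 1) / 8).val, ZMod.val_lt _, fun k hk => ha ?_⟩
  have h : ((tri k : ℕ) : ZMod p) = (a - 1) / 8 := by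
    rw [← ZMod.natCast_zmod_val ((a - 1) / 8), ← hk, ZMod.natCast_mod]
  have t := congrArg (Int.cast : ℤ → ZMod p) (tri_cast k)
  push_cast at t
  rw [h] at t
  have e : (a - 1) / 8 * 8 = a - 1 := div_mul_cancel₀ _ h8
  exact ⟨2 * k + 1, by linear_combination -e + 4 * t⟩

theorem exists_nat_tri_mod_eq {p : ℕ} (hp : p.Prime) (h2 : p ≠ 2) (k : ℤ) :
    ∃ κ : ℕ, 2 * κ + 1 ≤ p ∧ tri κ % p = tri k % p := by
  have hpos : (0 : ℤ) < p := by exact_mod_cast hp.pos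
  have h1 := Int.emod_nonneg k hpos.ne'
  have h3 := Int.emod_lt_of_pos k hpos
  have h4 := Int.emod_add_mul_ediv k p
  rcases le_or_gt (2 * (k % p) + 1) p with h | h
  · refine ⟨(k % p).toNat, by omega, ?_⟩
    rw [tri_mod_eq_iff hp h2, Int.toNat_of_nonneg h1]
    exact Or.inl ⟨-(k / p), by linear_combination h4⟩
  · refine ⟨(p - 1 - k % p).toNat, by omega, ?_⟩
    rw [tri_mod_eq_iff hp h2, Int.toNat_of_nonneg (by omega)]
    exact Or.inr ⟨1 + k / p, by linear_combination -h4⟩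

theorem eventually_sign_comp_cube {p r : ℕ} (hp : p.Prime) (h2 : p ≠ 2) (hr : r < p) {k : ℤ}
    (hk : tri k % p = r) : ∃ τ : SignType, τ ≠ 0 ∧
      ∀ᶠ n in atTop, SignType.sign (c p 3 (p * n + r)) = τ := by
  obtain ⟨κ, hκ, hκr⟩ := exists_nat_tri_mod_eq hp h2 k
  rw [hk] at hκr
  have hF := comp_borweinProduct_pow hr 3
  have hc : ∀ n, c p 3 (p * n + r) = coeff n (comp p r (borweinProduct p ^ 3)) := fun n => by
    rw [coeff_comp, c]
  simp only [hc]
  set F := comp p r (borweinProduct p ^ 3)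
  rcases hκ.eq_or_lt with h | h
  · rw [comp_cube_of_two_mul_add_one_eq hp h2 hr h hκr, ← partProd_not_dvd_mul hp.pos] at hF
    set U := {k | ¬ p ∣ k}
    have h3 : F * partProd U ^ 3 = C ((-1) ^ κ * (p : ℝ)) * X ^ (tri κ / p) := by
      apply mul_right_cancel₀ (pow_ne_zero 3 (qProd_ne_zero hp.pos))
      linear_combination hF
    refine ⟨SignType.sign ((-1) ^ κ * (p : ℝ)), ?_, eventually_sign_of_mul_partProd (U := U)
      (s := tri κ / p) (g := (partProd U)⁻¹ * (partProd U)⁻¹) (Or.inl hp.not_dvd_one) ?_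
      ((coeffNonneg_inv_partProd U).mul (coeffNonneg_inv_partProd U)) ?_⟩
    · simp [sign_eq_zero_iff, hp.ne_zero]
    · rw [← h3]
      linear_combination (-F * partProd U * (1 + partProd U * (partProd U)⁻¹)) * partProd_mul_inv U
    · rw [coeff_zero_mul, coeff_zero_inv_partProd]; norm_num
  · obtain ⟨v, hv⟩ : ∃ v, p = 2 * v + (2 * κ + 1) := by
      obtain ⟨j, hj⟩ := hp.odd_of_ne_two h2
      exact ⟨j - κ, by omega⟩
    have hdvd : ∀ n, 0 < n → n < p → ¬ p ∣ n := fun n h0 h1 => Nat.not_dvd_of_pos_of_lt h0 h1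
    rw [comp_cube_of_two_mul_add_one_lt (v := v) hp h2 hr (by omega) rfl (by omega) hκr] at hF
    set u := v + (2 * κ + 1) with hu
    have hq := partProd_compl_mul_poch (p := p) (u := u) (v := v) hp.pos (by omega) (by omega)
      (by
        have := hdvd (2 * κ + 1) (by omega) h
        rw [hu]; push_cast
        rw [add_sub_cancel_left]
        exact_mod_cast this)
      (hdvd _ (by omega) (by omega)) (hdvd _ (by omega) (by omega))
    set U := {k | k ∉ progression u p ∧ k ∉ progression v p ∧ k ∉ progression p p}
    set θ := poch (-1) u p * poch (-1) v p * qProd p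
    set L := C (2 * κ + 1 : ℝ) +
      C (2 * p : ℝ) * ∑' n : ℕ, (lambert (v + p * n) - lambert (u + p * n)) with hL
    have hθ : θ ≠ 0 := fun h0 => by
      rw [h0, mul_zero] at hq
      exact qProd_ne_zero one_pos hq.symm
    -- The theta product θ cancels against one of the three copies of E, leaving the product over
    -- parts not congruent to u, v or 0 mod p.
    have h3 : F * qProd 1 ^ 2 * partProd U = C ((-1) ^ κ) * X ^ (tri κ / p) * L := by
      apply mul_right_cancel₀ hθ
      linear_combination hF + F * qProd 1 ^ 2 * hq
    set M := L * (1 - X ^ 1 : ℝ⟦X⟧)⁻¹ with hM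
    have hX : (1 - X ^ 1 : ℝ⟦X⟧) * (1 - X ^ 1 : ℝ⟦X⟧)⁻¹ = 1 :=
      PowerSeries.mul_inv_cancel _ (by simp)
    have hM0 : CoeffNonneg M := by
      rw [hM, hL, add_mul, mul_assoc]
      refine .add (fun n => ?_) fun n => ?_
      · rw [coeff_C_mul]
        exact mul_nonneg (by positivity) (coeffNonneg_inv_one_sub_X_pow one_pos n)
      · rw [coeff_C_mul]
        exact mul_nonneg (by positivity)
          (coeffNonneg_tsum_lambert hp.pos (by omega) (by omega) n)
    have hM1 : 0 < coeff 0 M := by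
      rw [hM, hL, add_mul, map_add, mul_assoc, coeff_C_mul, coeff_C_mul,
        coeff_inv_one_sub_X_pow one_pos (one_dvd _)]
      have := coeffNonneg_tsum_lambert (u := u) (v := v) hp.pos (by omega) (by omega) 0
      positivity
    -- A second copy of E supplies the factor 1 - q that makes `L` nonnegative; the third stays as
    -- the partition denominator.
    have h4 : qProd 1 = partProd (Set.univ \ {1}) * (1 - X ^ 1) := by
      rw [← partProd_univ, partProd_eq_mul one_pos (Set.mem_univ _)]
    set V : Set ℕ := Set.univ \ {1}
    have h5 : F * qProd 1 * partProd V * partProd U = C ((-1) ^ κ) * X ^ (tri κ / p) * M := by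
      apply mul_right_cancel₀ (isUnit_one_sub_X_pow one_pos).ne_zero
      linear_combination h3 - F * qProd 1 * partProd U * h4 +
        C ((-1) ^ κ) * X ^ (tri κ / p) * L * (-hX)
    refine ⟨SignType.sign ((-1) ^ κ), ?_, eventually_sign_of_mul_partProd (U := Set.univ)
      (s := tri κ / p) (g := M * ((partProd V)⁻¹ * (partProd U)⁻¹)) (Or.inl (Set.mem_univ _)) ?_
      (hM0.mul ((coeffNonneg_inv_partProd V).mul (coeffNonneg_inv_partProd U))) ?_⟩
    · simp [sign_eq_zero_iff]
    · rw [partProd_univ, ← mul_assoc, ← h5]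
      linear_combination (-F * qProd 1 * partProd U * (partProd U)⁻¹) * partProd_mul_inv V -
        F * qProd 1 * partProd_mul_inv U
    · rw [coeff_zero_mul M, coeff_zero_mul (partProd V)⁻¹, coeff_zero_inv_partProd, coeff_zero_inv_partProd]
      linarith

theorem signConjecture_three {p : ℕ} (hp : p.Prime) (h2 : p ≠ 2) : SignConjecture p 3 := by
  obtain ⟨τ₁, hτ₁, h₁⟩ := eventually_sign_comp_cube hp h2 hp.pos (k := 0) (by simp [tri])
  have hz : ∀ r < p, (∀ k : ℤ, tri k % p ≠ r) →
      ∀ᶠ n in atTop, SignType.sign (c p 3 (p * n + r)) = 0 := by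
    intro r hr hk
    have h : comp p r (qProd 1 ^ 3) = 0 := by
      apply eq_of_two_mul_eq
      rw [mul_zero]
      refine (hasSum_comp_cube hr).unique ?_
      simp only [hk, if_false, mul_zero]
      exact hasSum_zero
    have hF := comp_borweinProduct_pow hr 3
    rw [h] at hF
    have := (mul_eq_zero.1 hF).resolve_right (pow_ne_zero 3 (qProd_ne_zero one_pos))
    refine Eventually.of_forall fun n => ?_
    rw [c, ← coeff_comp, this, map_zero, sign_zero]
  obtain ⟨r₂, hr₂, h₂⟩ := exists_forall_tri_mod_ne hp h2
  refine signConjecture_of_eventually_sign hp (fun r hr => ?_) hτ₁ h₁ (hz r₂ hr₂ h₂)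
  by_cases hk : ∃ k : ℤ, tri k % p = r
  · obtain ⟨k, hk⟩ := hk
    obtain ⟨τ, -, h⟩ := eventually_sign_comp_cube hp h2 hr hk
    exact ⟨τ, h⟩
  · push Not at hk
    exact ⟨0, hz r hr hk⟩

/-! ### Pentagonal series and the case p = 3, m = 1 -/

theorem hasSum_pentagonal {t : ℕ} (ht : 0 < t) :
    HasSum (fun k : ℤ => (C ((-1) ^ k) * X ^ (t * pentagonal k) : ℝ⟦X⟧)) (qProd t) := by
  have h := WithPiTopology.hasSum_pentagonalSeries ℝ
  have e : pentagonalSeries ℝ = qProd 1 := by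
    rw [← WithPiTopology.tprod_one_sub_X_pow, qProd]
    simp
  rw [e] at h
  have h2 := h.map (expand t ht.ne') (continuous_expand ht.ne')
  rw [expand_qProd _ one_pos, mul_one] at h2
  refine hasSum_of_eq h2 fun k => ?_
  simp only [Function.comp, map_mul, map_pow, expand_X, ← pow_mul]
  congr 1
  rcases Int.even_or_odd k with hk | hk
  · simp [Int.negOnePow_even k hk, hk.neg_one_zpow]
  · simp [Int.negOnePow_odd k hk, hk.neg_one_zpow]

theorem hasSum_comp_qProd {p r : ℕ} (hr : r < p) :
    HasSum (fun k : ℤ => C ((-1) ^ k) *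
      (if pentagonal k % p = r then X ^ (pentagonal k / p) else 0)) (comp p r (qProd 1)) :=
  hasSum_of_eq (hasSum_comp (hasSum_pentagonal one_pos) p r) fun k => by
    rw [comp_C_mul, one_mul, comp_X_pow hr]

theorem neg_one_zpow_eq {m n : ℤ} (h : Even (m - n)) : (-1 : ℝ) ^ m = (-1) ^ n := by
  rw [← sub_add_cancel m n, zpow_add₀ (by norm_num), h.neg_one_zpow, one_mul]

/-- Modulo 3 twice the pentagonal number of k is -k, so each class is a single progression κ + 3 s
and no class is empty. Completing the exponent in s gives a triple product with modulus 9. -/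
theorem comp_three_qProd {κ : ℤ} {u v r : ℕ} (hu : (u : ℤ) = 4 + 3 * κ) (hv : (v : ℤ) = 5 - 3 * κ)
    (hκ : pentagonal κ = r) (hr : r < 3) :
    comp 3 r (qProd 1) = C ((-1) ^ κ) * (poch (-1) u 9 * poch (-1) v 9 * qProd 9) := by
  have h := hasSum_comp_qProd hr
  have hg : Function.Injective fun s : ℤ => κ + 3 * s := fun a b hab => by simpa using hab
  rw [← hg.hasSum_iff] at h
  · refine h.unique ?_
    have h1 := jacobi_triple_product (α := -1) (by norm_num) (u := u) (v := v) (p := 9)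
      (by norm_num) (by omega)
    rw [show (-1 : ℝ)⁻¹ = -1 by norm_num] at h1
    refine hasSum_of_eq (h1.mul_left (C ((-1) ^ κ))) fun s => ?_
    have e : pentagonal (κ + 3 * s) = r + 3 * jexp u v s := by
      zify
      apply mul_right_cancel₀ (two_ne_zero (α := ℤ))
      have t1 := two_mul_natCast_pentagonal (κ + 3 * s)
      have t2 := two_mul_natCast_pentagonal κ
      have t3 := jexp_cast u v s
      rw [hu, hv] at t3
      rw [← hκ]
      linear_combination t1 - t2 - 3 * t3
    simp only [Function.comp]
    rw [e, Nat.add_mul_mod_self_left, Nat.mod_eq_of_lt hr, if_pos rfl,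
      Nat.add_mul_div_left _ _ (by norm_num), Nat.div_eq_of_lt hr, zero_add, ← mul_assoc, ← map_mul]
    rw [← zpow_add₀ (by norm_num), neg_one_zpow_eq (n := κ + s) ⟨s, by ring⟩]
  · intro k hk
    rw [if_neg, mul_zero]
    intro hk'
    apply hk
    have t1 := two_mul_natCast_pentagonal k
    have t2 := two_mul_natCast_pentagonal κ
    have : ∃ z : ℤ, (pentagonal k : ℤ) - pentagonal κ = 3 * z := ⟨pentagonal k / 3, by omega⟩
    obtain ⟨z, hz⟩ := this
    exact ⟨(k * k - κ * κ) - 2 * z, by linear_combination t2 - t1 + 2 * hz⟩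

theorem eventually_sign_comp_three {κ : ℤ} {u v r : ℕ} (hu : (u : ℤ) = 4 + 3 * κ)
    (hv : (v : ℤ) = 5 - 3 * κ) (hκ : pentagonal κ = r) (hr : r < 3) :
    ∀ᶠ n in atTop, SignType.sign (c 3 1 (3 * n + r)) = SignType.sign ((-1 : ℝ) ^ κ) := by
  have hF := comp_borweinProduct_pow hr 1
  rw [pow_one, pow_one, comp_three_qProd hu hv hκ hr] at hF
  have hq := partProd_compl_mul_poch (p := 9) (u := u) (v := v) (by norm_num) (by omega) (by omega)
    (by push_cast; omega) (by omega) (by omega)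
  set U := {k | k ∉ progression u 9 ∧ k ∉ progression v 9 ∧ k ∉ progression 9 9} with hU
  have hθ : poch (-1) u 9 * poch (-1) v 9 * qProd 9 ≠ 0 := fun h0 => by
    rw [h0, mul_zero] at hq
    exact qProd_ne_zero one_pos hq.symm
  have h3 : comp 3 r (borweinProduct 3) * partProd U = C ((-1) ^ κ) * X ^ 0 * 1 := by
    apply mul_right_cancel₀ hθ
    rw [mul_assoc, hq, hF, pow_zero, mul_one, mul_one]
  have h1U : 1 ∈ U ∨ 2 ∈ U ∧ 3 ∈ U := by
    have hmem : ∀ k, k < 10 → k ≠ u → k ≠ v → k ≠ 9 → k ∈ U := fun k hk h1 h2 h3 =>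
      ⟨fun ⟨n, hn⟩ => by omega, fun ⟨n, hn⟩ => by omega, fun ⟨n, hn⟩ => by omega⟩
    -- Part 1 is lost only when u = 1 (then v = 8), and in that case 2 and 3 are available.
    by_cases h : u = 1
    · exact Or.inr ⟨hmem _ (by omega) (by omega) (by omega) (by omega),
        hmem _ (by omega) (by omega) (by omega) (by omega)⟩
    · exact Or.inl (hmem _ (by omega) (by omega) (by omega) (by omega))
  filter_upwards [eventually_sign_of_mul_partProd h1U h3 .one (by simp)] with n hn
  rw [c, pow_one, ← coeff_comp, hn]

theorem signConjecture_three_one : SignConjecture 3 1 := by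
  have h0 := eventually_sign_comp_three (κ := 0) (u := 4) (v := 5) (r := 0) (by norm_num)
    (by norm_num) rfl (by norm_num)
  have h1 := eventually_sign_comp_three (κ := 1) (u := 7) (v := 2) (r := 1) (by norm_num)
    (by norm_num) rfl (by norm_num)
  have h2 := eventually_sign_comp_three (κ := -1) (u := 1) (v := 8) (r := 2) (by norm_num)
    (by norm_num) rfl (by norm_num)
  refine signConjecture_of_eventually_sign Nat.prime_three (fun r hr => ?_) (by simp) h0 h1
  interval_cases r
  · exact ⟨_, h0⟩
  · exact ⟨_, h1⟩
  · exact ⟨_, h2⟩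

/-! ### The quintuple product identity -/

theorem summable_monomial {ι : Type*} (α : ι → ℝ) {e : ι → ℕ} (h : ∀ d, {i | e i ≤ d}.Finite) :
    Summable fun i => (C (α i) * X ^ e i : ℝ⟦X⟧) := by
  rw [WithPiTopology.summable_iff_summable_coeff]
  intro d
  refine summable_of_hasFiniteSupport ((h d).subset fun i hi => ?_)
  by_contra hc
  apply hi
  have hc : ¬ e i ≤ d := hc
  exact (coeff_C_mul_X_pow _ _ _).trans (if_neg (by omega))

theorem finite_jexp_le {u v : ℕ} (h : 0 < u + v) (d : ℕ) : {j : ℤ | jexp u v j ≤ d}.Finite :=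
  (Set.finite_Icc (-(d + 1) : ℤ) (d + 1)).subset fun _ hj =>
    abs_le.1 (abs_le_of_jexp_le h hj)

/-- The exponents in the product of the two theta series
`∑ X ^ (a i + p i (i - 1) / 2)` and `∑ (-1) ^ j X ^ (2 a j + p j ^ 2)`. -/
def quintExp (p a : ℕ) (x : ℤ × ℤ) : ℕ :=
  jexp a (p - a) x.1 + jexp (p + 2 * a) (p - 2 * a) x.2

theorem quintExp_cast {p a : ℕ} (h : 2 * a < p) (x : ℤ × ℤ) :
    (quintExp p a x : ℤ) * 2 = 2 * a * x.1 + p * (x.1 * (x.1 - 1)) + 4 * a * x.2 +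
      2 * p * x.2 ^ 2 := by
  have h1 := jexp_cast a (p - a) x.1
  have h2 := jexp_cast (p + 2 * a) (p - 2 * a) x.2
  rw [quintExp]
  push_cast [Nat.cast_sub (show a ≤ p by omega), Nat.cast_sub h.le] at *
  linear_combination h1 + h2

theorem finite_quintExp_le {p a : ℕ} (h : 2 * a < p) (d : ℕ) :
    {x | quintExp p a x ≤ d}.Finite :=
  ((finite_jexp_le (u := a) (v := p - a) (by omega) d).prod
    (finite_jexp_le (u := p + 2 * a) (v := p - 2 * a) (by omega) d)).subset fun x hx =>
      ⟨(Nat.le_add_right _ _).trans hx, (Nat.le_add_left _ _).trans hx⟩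

theorem finite_quintExp_comp_le {ι : Type*} {p a : ℕ} (h : 2 * a < p) {g : ι → ℤ × ℤ}
    (hg : Function.Injective g) (d : ℕ) : {i | quintExp p a (g i) ≤ d}.Finite :=
  (finite_quintExp_le h d).preimage hg.injOn

theorem hasSum_of_three_injective {ι κ : Type*} {g₁ g₂ g₃ : ι → κ}
    (h₁ : Function.Injective g₁) (h₂ : Function.Injective g₂) (h₃ : Function.Injective g₃)
    (h₁₂ : ∀ s t, g₁ s ≠ g₂ t) (h₁₃ : ∀ s t, g₁ s ≠ g₃ t) (h₂₃ : ∀ s t, g₂ s ≠ g₃ t)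
    (hc : ∀ k, (∃ s, g₁ s = k) ∨ (∃ s, g₂ s = k) ∨ ∃ s, g₃ s = k) {f : κ → ℝ⟦X⟧} {a₁ a₂ a₃ : ℝ⟦X⟧}
    (s₁ : HasSum (fun s => f (g₁ s)) a₁) (s₂ : HasSum (fun s => f (g₂ s)) a₂)
    (s₃ : HasSum (fun s => f (g₃ s)) a₃) : HasSum f (a₁ + a₂ + a₃) := by
  refine hasSum_of_eq (((hasSum_indicator_range h₁ s₁).add (hasSum_indicator_range h₂ s₂)).add
    (hasSum_indicator_range h₃ s₃)) fun k => ?_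
  have d : ∀ {g g' : ι → κ}, (∀ s t, g s ≠ g' t) → ∀ s, g s ∉ Set.range g' :=
    fun h s ⟨t, ht⟩ => h s t ht.symm
  rcases hc k with ⟨s, rfl⟩ | ⟨s, rfl⟩ | ⟨s, rfl⟩
  · simp [d h₁₂ s, d h₁₃ s]
  · simp [d (fun s t => (h₁₂ t s).symm) s, d h₂₃ s]
  · simp [d (fun s t => (h₁₃ t s).symm) s, d (fun s t => (h₂₃ t s).symm) s]

theorem hasSum_mul_of_monomial {ι κ : Type*} {f : ι → ℝ⟦X⟧} {g : κ → ℝ⟦X⟧} {a b : ℝ⟦X⟧}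
    (hf : HasSum f a) (hg : HasSum g b) {α : ι × κ → ℝ} {e : ι × κ → ℕ}
    (he : ∀ d, {x | e x ≤ d}.Finite) (h : ∀ x, C (α x) * X ^ e x = f x.1 * g x.2) :
    HasSum (fun x => (C (α x) * X ^ e x : ℝ⟦X⟧)) (a * b) := by
  have hs : Summable fun x : ι × κ => f x.1 * g x.2 := by
    simpa only [h] using summable_monomial α he
  simpa only [h] using hf.mul hg hs

theorem hasSum_quintExp {p a : ℕ} (h : 2 * a < p) :
    HasSum (fun x : ℤ × ℤ => (C ((-1) ^ x.2) * X ^ quintExp p a x : ℝ⟦X⟧))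
      ((poch 1 a p * poch 1 (p - a) p * qProd p) *
      (poch (-1) (p + 2 * a) (2 * p) * poch (-1) (p - 2 * a) (2 * p) * qProd (2 * p))) := by
  have t1 := jacobi_triple_product (α := 1) one_ne_zero (u := a) (v := p - a) (p := p)
    (by omega) (by omega)
  have t2 := jacobi_triple_product (α := -1) (by norm_num) (u := p + 2 * a) (v := p - 2 * a)
    (p := 2 * p) (by omega) (by omega)
  rw [inv_one] at t1
  rw [show (-1 : ℝ)⁻¹ = -1 by norm_num] at t2
  refine hasSum_mul_of_monomial t1 t2 (finite_quintExp_le h) fun x => ?_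
  rw [one_zpow, map_one, quintExp, pow_add]; ring

/-- Along coordinates (s, l) in which the exponent and the sign separate, the double series factors
into a series in s times one in l. -/
theorem hasSum_quintExp_mul {p a : ℕ} (h : 2 * a < p) {g : ℤ × ℤ → ℤ × ℤ}
    (hg : Function.Injective g) {e : ℤ → ℕ} {b : ℝ⟦X⟧}
    (hb : HasSum (fun l : ℤ => (C ((-1) ^ l) * X ^ e l : ℝ⟦X⟧)) b)
    (he : ∀ s l, quintExp p a (g (s, l)) = quintExp p a (g (s, 0)) + e l)
    (hs : ∀ s l, Even ((g (s, l)).2 - (s + l))) :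
    HasSum (fun x => (C ((-1) ^ (g x).2) * X ^ quintExp p a (g x) : ℝ⟦X⟧))
      ((∑' s : ℤ, (C ((-1) ^ s) * X ^ quintExp p a (g (s, 0)) : ℝ⟦X⟧)) * b) := by
  have h0 : Function.Injective fun s : ℤ => g (s, 0) := fun s t hst => by
    simpa using hg hst
  refine hasSum_mul_of_monomial (summable_monomial (fun s : ℤ => (-1) ^ s)
    (finite_quintExp_comp_le h h0)).hasSum hb (α := fun x => (-1) ^ (g x).2)
    (finite_quintExp_comp_le h hg) fun x => ?_
  obtain ⟨s, l⟩ := x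
  rw [he, neg_one_zpow_eq (hs s l), zpow_add₀ (by norm_num), map_mul, pow_add]
  ring

/-- The quintuple product identity. -/
theorem quintuple_product {p a : ℕ} (h : 2 * a < p) :
    ((∑' s : ℤ, (C ((-1) ^ s) * X ^ quintExp p a (s, s) : ℝ⟦X⟧)) +
      ∑' s : ℤ, (C ((-1) ^ s) * X ^ quintExp p a (s + 1, s) : ℝ⟦X⟧)) * qProd (2 * p) =
    (poch 1 a p * poch 1 (p - a) p * qProd p) *
      (poch (-1) (p + 2 * a) (2 * p) * poch (-1) (p - 2 * a) (2 * p) * qProd (2 * p)) := by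
  have hp : 0 < p := by omega
  -- The lattice of pairs (i, j) is split by i + 2 j mod 3. These maps parametrise the three cosets
  -- by coordinates separating the quadratic exponent.
  have inj₁ : Function.Injective fun x : ℤ × ℤ => (x.1 + 2 * x.2, x.1 - x.2) := by
    rintro ⟨s, l⟩ ⟨s', l'⟩ hh
    simp only [Prod.mk.injEq] at hh ⊢
    omega
  have inj : ∀ ρ : ℤ, Function.Injective fun x : ℤ × ℤ => (x.1 + ρ - 2 * x.2, x.1 + x.2) := by
    rintro ρ ⟨s, l⟩ ⟨s', l'⟩ hh
    simp only [Prod.mk.injEq] at hh ⊢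
    omega
  -- On the third coset the series in l is a triple product containing the factor 1 - q^0, so that
  -- coset contributes 0. The first two give Euler's product in q^(2p).
  have hz := jacobi_triple_product (α := -1) (by norm_num) (u := 0) (v := 6 * p) (p := 6 * p)
    (by omega) (by omega)
  have hz0 : poch (-1) 0 (6 * p) = 0 := by rw [poch_eq_mul _ _ (by omega)]; norm_num
  rw [hz0, zero_mul, zero_mul] at hz
  have hP := hasSum_pentagonal (t := 2 * p) (by omega)
  have s₁ := hasSum_quintExp_mul h inj₁ hP
    (fun s l => by
      zify
      apply mul_right_cancel₀ (two_ne_zero (α := ℤ))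
      have e1 := quintExp_cast h (s + 2 * l, s - l)
      have e2 := quintExp_cast h (s + 2 * 0, s - 0)
      have e3 := two_mul_natCast_pentagonal l
      linear_combination e1 - e2 - 2 * p * e3) (fun s l => ⟨-l, by ring⟩)
  have s₂ := hasSum_quintExp_mul h (inj 1) hP
    (fun s l => by
      zify
      apply mul_right_cancel₀ (two_ne_zero (α := ℤ))
      have e1 := quintExp_cast h (s + 1 - 2 * l, s + l)
      have e2 := quintExp_cast h (s + 1 - 2 * 0, s + 0)
      have e3 := two_mul_natCast_pentagonal l
      linear_combination e1 - e2 - 2 * p * e3) (fun s l => ⟨0, by ring⟩)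
  have s₃ := hasSum_quintExp_mul h (inj 2) hz
    (fun s l => by
      zify
      apply mul_right_cancel₀ (two_ne_zero (α := ℤ))
      have e1 := quintExp_cast h (s + 2 - 2 * l, s + l)
      have e2 := quintExp_cast h (s + 2 - 2 * 0, s + 0)
      have e3 := jexp_cast 0 (6 * p) l
      push_cast at e3
      linear_combination e1 - e2 - e3) (fun s l => ⟨0, by ring⟩)
  have key := hasSum_of_three_injective inj₁ (inj 1) (inj 2)
    (by
      rintro ⟨s, l⟩ ⟨s', l'⟩ hh
      simp only [Prod.mk.injEq] at hh
      omega)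
    (by
      rintro ⟨s, l⟩ ⟨s', l'⟩ hh
      simp only [Prod.mk.injEq] at hh
      omega)
    (by
      rintro ⟨s, l⟩ ⟨s', l'⟩ hh
      simp only [Prod.mk.injEq] at hh
      omega)
    (by
      rintro ⟨i, j⟩
      have h3 : (i + 2 * j) % 3 = 0 ∨ (i + 2 * j) % 3 = 1 ∨ (i + 2 * j) % 3 = 2 := by omega
      simp only [Prod.mk.injEq, Prod.exists]
      rcases h3 with h3 | h3 | h3
      · exact Or.inl ⟨(i + 2 * j) / 3, (i + 2 * j) / 3 - j, by omega, by omega⟩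
      · exact Or.inr (Or.inl ⟨(i + 2 * j) / 3, j - (i + 2 * j) / 3, by omega, by omega⟩)
      · exact Or.inr (Or.inr ⟨(i + 2 * j) / 3, j - (i + 2 * j) / 3, by omega, by omega⟩))
    (f := fun x : ℤ × ℤ => C ((-1) ^ x.2) * X ^ quintExp p a x) s₁ s₂ s₃
  rw [← key.unique (hasSum_quintExp h)]
  simp only [mul_zero, add_zero, sub_zero]
  ring

/-! ### The case m = 1, p ≥ 5 -/

theorem not_dvd_of_prime_of_ne {p q : ℕ} (hp : p.Prime) (hq : q.Prime) (h : p ≠ q) :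
    ¬ (p : ℤ) ∣ q := fun hd =>
  h ((Nat.prime_dvd_prime_iff_eq hp hq).1 (by exact_mod_cast hd))

/-- Because 6 w ≡ -1 mod p, the quadratic is symmetric about -w mod p: a class is k ≡ -w ± a. The
sign ε accounts for p ≡ ±1 mod 6. -/
theorem pentagonal_mod_eq_iff {p : ℕ} (hp : p.Prime) (h5 : 5 ≤ p) {ε w : ℤ}
    (hw : ε * p = 6 * w + 1) (k l : ℤ) :
    pentagonal k % p = pentagonal l % p ↔ (p : ℤ) ∣ k - l ∨ (p : ℤ) ∣ k + l + 2 * w := by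
  have hp' : Prime (p : ℤ) := Nat.prime_iff_prime_int.1 hp
  have h2 := not_dvd_of_prime_of_ne hp Nat.prime_two (by omega)
  have h3 := not_dvd_of_prime_of_ne hp Nat.prime_three (by omega)
  rw [← hp'.dvd_mul]
  have e : 3 * ((k - l) * (k + l + 2 * w)) =
      2 * ((pentagonal k : ℤ) - pentagonal l) + p * (ε * (k - l)) := by
    have h1 := two_mul_natCast_pentagonal k
    have h2 := two_mul_natCast_pentagonal l
    linear_combination h2 - h1 - (k - l) * hw
  change pentagonal k ≡ pentagonal l [MOD p] ↔ _
  rw [Nat.ModEq.comm, Nat.modEq_iff_dvd]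
  constructor
  · intro h
    have : (p : ℤ) ∣ 3 * ((k - l) * (k + l + 2 * w)) := by
      rw [e]; exact dvd_add (h.mul_left 2) (dvd_mul_right _ _)
    exact (hp'.dvd_or_dvd this).resolve_left h3
  · intro h
    have : (p : ℤ) ∣ 2 * ((pentagonal k : ℤ) - pentagonal l) := by
      rw [← dvd_add_left (dvd_mul_right (p : ℤ) (ε * (k - l))), ← e]
      exact h.mul_left 3
    exact (hp'.dvd_or_dvd this).resolve_left h2

theorem exists_sign_mul_eq {p : ℕ} (hp : p.Prime) (h5 : 5 ≤ p) :
    ∃ ε w : ℤ, (ε = 1 ∨ ε = -1) ∧ ε * p = 6 * w + 1 := by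
  have h2 : ¬ 2 ∣ p := fun h => by
    have := (Nat.prime_dvd_prime_iff_eq Nat.prime_two hp).1 h; omega
  have h3 : ¬ 3 ∣ p := fun h => by
    have := (Nat.prime_dvd_prime_iff_eq Nat.prime_three hp).1 h; omega
  have : p % 6 = 1 ∨ p % 6 = 5 := by omega
  rcases this with h | h
  · exact ⟨1, p / 6, Or.inl rfl, by omega⟩
  · exact ⟨-1, -(p / 6) - 1, Or.inr rfl, by omega⟩

theorem exists_nat_dvd_sub_or_dvd_add {p : ℕ} (hp : Odd p) (t : ℤ) :
    ∃ a : ℕ, 2 * a < p ∧ ((p : ℤ) ∣ t - a ∨ (p : ℤ) ∣ t + a) := by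
  obtain ⟨j, hj⟩ := hp
  have hpos : (0 : ℤ) < p := by omega
  have h1 := Int.emod_nonneg t hpos.ne'
  have h3 := Int.emod_lt_of_pos t hpos
  have h4 := Int.emod_add_mul_ediv t p
  rcases le_or_gt (t % p) j with h | h
  · exact ⟨(t % p).toNat, by omega, Or.inl ⟨t / p, by
      rw [Int.toNat_of_nonneg h1]; linear_combination -h4⟩⟩
  · exact ⟨(p - t % p).toNat, by omega, Or.inr ⟨t / p + 1, by
      rw [Int.toNat_of_nonneg (by omega)]; linear_combination -h4⟩⟩

/-- In the class a = 0 fixed by the reflection, the pentagonal exponents recur scaled by p², so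
Euler's product reappears in q^p. -/
theorem comp_qProd_of_zero {p r : ℕ} (hp : p.Prime) (h5 : 5 ≤ p) (hr : r < p) {ε w : ℤ}
    (hε : ε = 1 ∨ ε = -1) (hw : ε * p = 6 * w + 1) (hb : pentagonal (-w) % p = r) :
    comp p r (qProd 1) = C ((-1) ^ w) * X ^ (pentagonal (-w) / p) * qProd p := by
  have hε2 : ε * ε = 1 := by rcases hε with rfl | rfl <;> norm_num
  have hε0 : ε ≠ 0 := by rcases hε with rfl | rfl <;> norm_num
  obtain ⟨j, hj⟩ := hp.odd_of_ne_two (by omega)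
  have hjz : (p : ℤ) = 2 * j + 1 := by exact_mod_cast hj
  have h := hasSum_comp_qProd hr
  have hg : Function.Injective fun s : ℤ => ε * (p * s) - w := fun a b hab => by
    simpa [hε0, hp.ne_zero] using hab
  rw [← hg.hasSum_iff] at h
  · refine h.unique ?_
    refine hasSum_of_eq ((hasSum_pentagonal hp.pos).mul_left _) fun s => ?_
    have e : pentagonal (ε * (p * s) - w) = pentagonal (-w) + p * (p * pentagonal s) := by
      zify
      apply mul_right_cancel₀ (two_ne_zero (α := ℤ))
      have t1 := two_mul_natCast_pentagonal (ε * (p * s) - w)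
      have t2 := two_mul_natCast_pentagonal (-w)
      have t3 := two_mul_natCast_pentagonal s
      linear_combination t1 - t2 - p ^ 2 * t3 + 3 * p ^ 2 * s ^ 2 * hε2 - p ^ 2 * s * hε2 +
        ε * p * s * hw
    have es : (-1 : ℝ) ^ (ε * (p * s) - w) = (-1) ^ w * (-1) ^ s := by
      rw [← zpow_add₀ (by norm_num)]
      apply neg_one_zpow_eq
      rcases hε with rfl | rfl
      · exact ⟨j * s - w, by rw [hjz]; ring⟩
      · exact ⟨-(j + 1) * s - w, by rw [hjz]; ring⟩
    simp only [Function.comp]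
    rw [es, e, Nat.add_mul_mod_self_left, if_pos hb, Nat.add_mul_div_left _ _ hp.pos, pow_add,
      map_mul]
    ring
  · intro k hk
    rw [if_neg, mul_zero]
    intro hk'
    rw [← hb, pentagonal_mod_eq_iff hp h5 hw] at hk'
    apply hk
    rcases hk' with ⟨s, hs⟩ | ⟨s, hs⟩
    · exact ⟨ε * s, by simp only; linear_combination -hs + p * s * hε2⟩
    · exact ⟨ε * s, by simp only; linear_combination -hs + p * s * hε2⟩

/-- The progressions k = ε (a + p s) - w and k = -ε (a + p s) - w yield precisely the two series of
the quintuple product. -/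
theorem comp_qProd_of_pos {p r a : ℕ} (hp : p.Prime) (h5 : 5 ≤ p) (hr : r < p) {ε w : ℤ}
    (hε : ε = 1 ∨ ε = -1) (hw : ε * p = 6 * w + 1) (ha : 0 < a) (hap : 2 * a < p)
    (hb : pentagonal (ε * a - w) % p = r) :
    comp p r (qProd 1) = C ((-1) ^ (a + w)) * X ^ (pentagonal (ε * a - w) / p) *
      ((∑' s : ℤ, (C ((-1) ^ s) * X ^ quintExp p a (s, s) : ℝ⟦X⟧)) +
      ∑' s : ℤ, (C ((-1) ^ s) * X ^ quintExp p a (s + 1, s) : ℝ⟦X⟧)) := by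
  have hε2 : ε * ε = 1 := by rcases hε with rfl | rfl <;> norm_num
  have hε0 : ε ≠ 0 := by rcases hε with rfl | rfl <;> norm_num
  obtain ⟨j, hj⟩ := hp.odd_of_ne_two (by omega)
  have hjz : (p : ℤ) = 2 * j + 1 := by exact_mod_cast hj
  have hp0 := hp.ne_zero
  have key : ∀ (δ : ℤ) (δ' : ℤ), δ = 1 ∧ δ' = 0 ∨ δ = -1 ∧ δ' = 1 →
      HasSum (fun s : ℤ => C ((-1) ^ (ε * (δ * (a + p * s)) - w)) *
        (if pentagonal (ε * (δ * (a + p * s)) - w) % p = r then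
          (X : ℝ⟦X⟧) ^ (pentagonal (ε * (δ * (a + p * s)) - w) / p) else 0))
      (C ((-1) ^ (a + w)) * X ^ (pentagonal (ε * a - w) / p) *
        ∑' s : ℤ, (C ((-1) ^ s) * X ^ quintExp p a (s + δ', s))) := by
    intro δ δ' hδ
    have hs := (summable_monomial (fun s : ℤ => (-1) ^ s) (finite_quintExp_comp_le hap
      (g := fun s : ℤ => (s + δ', s)) fun s t hst => (Prod.mk.inj hst).2)).hasSum
    refine hasSum_of_eq (hs.mul_left _) fun s => ?_
    have e : pentagonal (ε * (δ * (a + p * s)) - w) =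
        pentagonal (ε * a - w) + p * quintExp p a (s + δ', s) := by
      zify
      apply mul_right_cancel₀ (two_ne_zero (α := ℤ))
      have t1 := two_mul_natCast_pentagonal (ε * (δ * (a + p * s)) - w)
      have t2 := two_mul_natCast_pentagonal (ε * a - w)
      have t3 := quintExp_cast hap (s + δ', s)
      simp only at t3
      rcases hδ with ⟨rfl, rfl⟩ | ⟨rfl, rfl⟩
      · linear_combination t1 - t2 - p * t3 + (3 * (a + p * s) ^ 2 - 3 * a ^ 2) * hε2 +
          ε * (p * s) * hw - p ^ 2 * s * hε2
      · linear_combination t1 - t2 - p * t3 + (3 * (a + p * s) ^ 2 - 3 * a ^ 2) * hε2 -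
          ε * (2 * a + p * s) * hw + p * (2 * a + p * s) * hε2
    have es : (-1 : ℝ) ^ (ε * (δ * (a + p * s)) - w) = (-1) ^ (a + w) * (-1) ^ s := by
      rw [← zpow_add₀ (by norm_num)]
      apply neg_one_zpow_eq
      have : ε * δ = 1 ∨ ε * δ = -1 := by
        rcases hε with rfl | rfl <;> rcases hδ with ⟨rfl, -⟩ | ⟨rfl, -⟩ <;> norm_num
      rw [← mul_assoc]
      rcases this with h | h
      · exact ⟨j * s - w, by rw [h, hjz]; ring⟩
      · exact ⟨-(j + 1) * s - w - a, by rw [h, hjz]; ring⟩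
    rw [es, e, Nat.add_mul_mod_self_left, if_pos hb, Nat.add_mul_div_left _ _ hp.pos, pow_add,
      map_mul]
    ring
  have h1 := key 1 0 (by simp)
  have h2 := key (-1) 1 (by simp)
  have h7 := hasSum_of_two_injective (f := fun k : ℤ => C ((-1) ^ k) *
      (if pentagonal k % p = r then (X : ℝ⟦X⟧) ^ (pentagonal k / p) else 0))
    (fun x y hxy => by simpa [hp0, hε0] using hxy)
    (fun x y hxy => by simpa [hp0, hε0] using hxy) (fun s t hst => ?_) (fun k hk hk' => ?_) h1 h2
  · rw [(hasSum_comp_qProd hr).unique h7, mul_add]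
    simp only [add_zero]
  · have h3 : ε * (2 * a + p * (s + t)) = 0 := by linear_combination hst
    have h4 := (mul_eq_zero.1 h3).resolve_left hε0
    have : (p : ℤ) ∣ 2 * a := ⟨-s - t, by linear_combination h4⟩
    have := Int.le_of_dvd (by positivity) this
    omega
  · rw [if_neg, mul_zero]
    intro hkr
    rw [← hb, pentagonal_mod_eq_iff hp h5 hw] at hkr
    rcases hkr with ⟨s, hs⟩ | ⟨s, hs⟩
    · exact hk (ε * s) (by linear_combination hs - p * s * hε2)
    · exact hk' (-(ε * s)) (by linear_combination hs - p * s * hε2)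

theorem eventually_sign_comp_one {p r : ℕ} (hp : p.Prime) (h5 : 5 ≤ p) (hr : r < p) {k : ℤ}
    (hk : pentagonal k % p = r) : ∃ τ : SignType, τ ≠ 0 ∧
      ∀ᶠ n in atTop, SignType.sign (c p 1 (p * n + r)) = τ := by
  obtain ⟨ε, w, hε, hw⟩ := exists_sign_mul_eq hp h5
  have hodd := hp.odd_of_ne_two (by omega)
  obtain ⟨a, hap, ha⟩ := exists_nat_dvd_sub_or_dvd_add hodd (k + w)
  have hb : pentagonal (ε * a - w) % p = r := by
    rw [← hk, pentagonal_mod_eq_iff hp h5 hw]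
    rcases hε with rfl | rfl <;> rcases ha with ⟨z, hz⟩ | ⟨z, hz⟩
    · exact Or.inl ⟨-z, by linear_combination -hz⟩
    · exact Or.inr ⟨z, by linear_combination hz⟩
    · exact Or.inr ⟨z, by linear_combination hz⟩
    · exact Or.inl ⟨-z, by linear_combination -hz⟩
  have hF := comp_borweinProduct_pow hr 1
  rw [pow_one, pow_one] at hF
  have hc : ∀ n, c p 1 (p * n + r) = coeff n (comp p r (borweinProduct p)) := fun n => by
    rw [coeff_comp, c, pow_one]
  simp only [hc]
  set F := comp p r (borweinProduct p)
  rcases a.eq_zero_or_pos with rfl | ha0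
  · rw [Nat.cast_zero, mul_zero, zero_sub] at hb
    rw [comp_qProd_of_zero hp h5 hr hε hw hb, ← partProd_not_dvd_mul hp.pos] at hF
    refine ⟨SignType.sign ((-1 : ℝ) ^ w), ?_, eventually_sign_of_mul_partProd
      (U := {k | ¬ p ∣ k}) (s := pentagonal (-w) / p) (g := 1) (Or.inl hp.not_dvd_one) ?_
      .one (by simp)⟩
    · rw [Ne, sign_eq_zero_iff]
      exact zpow_ne_zero _ (by norm_num)
    · apply mul_right_cancel₀ (qProd_ne_zero hp.pos)
      linear_combination hF
  · have hquint := quintuple_product hap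
    rw [comp_qProd_of_pos hp h5 hr hε hw ha0 hap hb] at hF
    have hnd : ∀ b : ℕ, 0 < b → b < p → ¬ (p : ℤ) ∣ b := fun b h1 h2 h =>
      Nat.not_dvd_of_pos_of_lt h1 h2 (by exact_mod_cast h)
    have h2a := hnd (2 * a) (by omega) hap
    obtain ⟨j, hj⟩ := hodd
    have hq := partProd_compl_mul (A := progression (p + 2 * a) (2 * p))
      (B := progression (p - 2 * a) (2 * p)) (D := progression p p)
      (notMem_progression_of_not_dvd (by
        rintro ⟨z, hz⟩
        apply h2a
        push_cast [Nat.cast_sub hap.le] at hz ⊢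
        exact ⟨z, by linarith⟩))
      (by
        rintro x ⟨n, rfl⟩ ⟨n', hn⟩
        apply h2a
        zify at hn
        push_cast
        exact ⟨n' - 2 * n, by linear_combination hn⟩)
      (by
        rintro x ⟨n, rfl⟩ ⟨n', hn⟩
        apply h2a
        zify [hap.le] at hn
        push_cast
        exact ⟨2 * n - n', by linear_combination -hn⟩)
    rw [← poch_eq_partProd (by omega) (by omega), ← poch_eq_partProd (by omega) (by omega),
      ← poch_eq_partProd hp.pos hp.pos, ← qProd_eq_poch] at hq
    set U := {k | k ∉ progression (p + 2 * a) (2 * p) ∧ k ∉ progression (p - 2 * a) (2 * p) ∧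
      k ∉ progression p p} with hU
    set D := poch (-1) (p + 2 * a) (2 * p) * poch (-1) (p - 2 * a) (2 * p) * qProd p with hD
    have hD0 : D ≠ 0 := fun h0 => by
      rw [h0, mul_zero] at hq
      exact qProd_ne_zero one_pos hq.symm
    -- Since p ≥ 5, the only possible excluded part below 4 is p - 2 a, so either 1 or both 2 and 3
    -- belong to `U`.
    have hmem : ∀ k, k < 4 → 0 < k → k ≠ p - 2 * a → k ∈ U := fun k h1 h2 h3 =>
      ⟨fun ⟨n, hn⟩ => by omega, fun ⟨n, hn⟩ => by
        rcases n.eq_zero_or_pos with rfl | hn0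
        · omega
        · nlinarith, fun ⟨n, hn⟩ => by omega⟩
    refine ⟨SignType.sign ((-1 : ℝ) ^ (a + w)), ?_, eventually_sign_of_mul_partProd
      (U := U) (s := pentagonal (ε * a - w) / p) (g := poch 1 a p * poch 1 (p - a) p) ?_ ?_
      ((coeffNonneg_poch zero_le_one _ hp.pos).mul (coeffNonneg_poch zero_le_one _ hp.pos)) ?_⟩
    · rw [Ne, sign_eq_zero_iff]
      exact zpow_ne_zero _ (by norm_num)
    · by_cases h1 : p - 2 * a = 1
      · exact Or.inr ⟨hmem _ (by omega) (by omega) (by omega),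
          hmem _ (by omega) (by omega) (by omega)⟩
      · exact Or.inl (hmem _ (by omega) (by omega) (by omega))
    · apply mul_right_cancel₀ hD0
      apply mul_right_cancel₀ (qProd_ne_zero (t := 2 * p) (by omega))
      rw [mul_assoc F, hq, hF, mul_assoc, hquint, hD]
      ring
    · rw [coeff_zero_mul, coeff_zero_poch _ ha0 hp.pos, coeff_zero_poch _ (by omega) hp.pos]
      norm_num

/-- Since 24 k (3 k - 1) / 2 + 1 = (6 k - 1)², a nonsquare a yields the missed residue (a - 1) / 24.
-/
theorem exists_forall_pentagonal_mod_ne {p : ℕ} (hp : p.Prime) (h5 : 5 ≤ p) :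
    ∃ r < p, ∀ k : ℤ, pentagonal k % p ≠ r := by
  have := Fact.mk hp
  have hne : ∀ q : ℕ, q.Prime → p ≠ q → (q : ZMod p) ≠ 0 := fun q hq h h0 =>
    h ((Nat.prime_dvd_prime_iff_eq hp hq).1 ((ZMod.natCast_eq_zero_iff q p).1 h0))
  have h24 : (24 : ZMod p) ≠ 0 := by
    rw [show (24 : ZMod p) = (2 : ℕ) ^ 3 * (3 : ℕ) by norm_num]
    exact mul_ne_zero (pow_ne_zero _ (hne 2 Nat.prime_two (by omega)))
      (hne 3 Nat.prime_three (by omega))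
  obtain ⟨a, ha⟩ := FiniteField.exists_nonsquare (F := ZMod p)
    (by rw [ZMod.ringChar_zmod_n]; omega)
  refine ⟨((a - 1) / 24).val, ZMod.val_lt _, fun k hk => ha ?_⟩
  have h : ((pentagonal k : ℕ) : ZMod p) = (a - 1) / 24 := by
    rw [← ZMod.natCast_zmod_val ((a - 1) / 24), ← hk, ZMod.natCast_mod]
  have t := congrArg (Int.cast : ℤ → ZMod p) (two_mul_natCast_pentagonal k)
  push_cast at t
  rw [h] at t
  have e : (a - 1) / 24 * 24 = a - 1 := div_mul_cancel₀ _ h24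
  exact ⟨6 * k - 1, by linear_combination -e + 12 * t⟩

theorem signConjecture_one {p : ℕ} (hp : p.Prime) (h5 : 5 ≤ p) : SignConjecture p 1 := by
  obtain ⟨τ₁, hτ₁, h₁⟩ := eventually_sign_comp_one hp h5 hp.pos (k := 0) (by simp [pentagonal])
  have hz : ∀ r < p, (∀ k : ℤ, pentagonal k % p ≠ r) →
      ∀ᶠ n in atTop, SignType.sign (c p 1 (p * n + r)) = 0 := by
    intro r hr hk
    have h : comp p r (qProd 1) = 0 := by
      refine (hasSum_comp_qProd hr).unique ?_
      simp only [hk, if_false, mul_zero]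
      exact hasSum_zero
    have hF := comp_borweinProduct_pow hr 1
    rw [pow_one (qProd 1), h] at hF
    have := (mul_eq_zero.1 hF).resolve_right (qProd_ne_zero one_pos)
    refine Eventually.of_forall fun n => ?_
    rw [c, ← coeff_comp, this, map_zero, sign_zero]
  obtain ⟨r₂, hr₂, h₂⟩ := exists_forall_pentagonal_mod_ne hp h5
  refine signConjecture_of_eventually_sign hp (fun r hr => ?_) hτ₁ h₁ (hz r₂ hr₂ h₂)
  by_cases hk : ∃ k : ℤ, pentagonal k % p = r
  · obtain ⟨k, hk⟩ := hk
    obtain ⟨τ, -, h⟩ := eventually_sign_comp_one hp h5 hr hk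
    exact ⟨τ, h⟩
  · push Not at hk
    exact ⟨0, hz r hr hk⟩

end Borwein

end

theorem mainTheorem6 :
    (∀ m : ℕ, 0 < m → Borwein.SignConjecture 2 m) ∧
      (∀ p : ℕ, p.Prime → ∀ m : ℕ, m = 1 ∨ m = 3 → Borwein.SignConjecture p m) := by
  refine ⟨fun m hm => Borwein.signConjecture_two hm, fun p hp m hm => ?_⟩
  by_cases h2 : p = 2
  · subst h2
    exact Borwein.signConjecture_two (by omega)
  rcases hm with rfl | rfl
  · by_cases h3 : p = 3
    · subst h3
      exact Borwein.signConjecture_three_one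
    · refine Borwein.signConjecture_one hp ?_
      have := hp.two_le
      by_contra hlt
      have h4 : p = 4 := by omega
      subst h4
      revert hp
      decide
  · exact Borwein.signConjecture_three hp h2
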